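/- Let $n\ge 1$ be an integer, $\frac{n}{n+1}<p\le 1$, and let $\Omega\subset\mathbb{R}^n$ be a uniform domain: a nonempty connected open set for which there is a constant $c>0$ such that any $x,y\in\Omega$ can be joined by a rectifiable path $\gamma:[0,T]\to\Omega$, parametrized by arclength, with $\gamma(0)=x$, $\gamma(T)=y$, $T\le c|x-y|$ and $B\big(\gamma(t),\tfrac1c\min(t,T-t)\big)\subset\Omega$ for all $t\in(0,T)$. Let $d(x,\partial\Omega)$ be the distance from $x$ to $\partial\Omega$, with $d(x,\partial\Omega)=\infty$ if $\Omega=\mathbb{R}^n$, and define three spaces of (a.e. classes of) measurable functions $u:\Omega\to\mathbb{R}$ as follows. * $M^{1,p}(\Omega)$ is the set of all $u\in L^p(\Omega)$ for which there are $g\in L^p(\Omega)$ and a set $F$ of measure zero with $$|u(x)-u(y)|\le |x-y|\,(g(x)+g(y))\qquad\text{for all } x,y\in\Omega\setminus F. \tag{1}$$ Its quasi-norm is $\|u\|_{M^{1,p}(\Omega)}=\inf_g\|g\|_{L^p(\Omega)}+\|u\|_{L^p(\Omega)}$, the infimum being over all such $g$. * $M^{1,p}_{ball}(\Omega)$ and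 its quasi-norm are defined in the same way, except that (1) is required only for those $x,y\in\Omega\setminus F$ with $|x-y|\le\frac14\min(d(x,\partial\Omega),d(y,\partial\Omega))$. * Fix an integer $N>\max(0,n(\frac1p-1))$. For a distribution $f\in\mathcal{D}'(\Omega)$ let $$\|f\|_{H^p(\Omega)}=\|\mathcal{M}f\|_{L^p(\Omega)},\qquad \mathcal{M}f(x)=\sup|\langle f,\varphi\rangle|,$$ where the supremum is over all real $r$ with $0<r\le\frac12d(x,\partial\Omega)$ and all $\varphi\in C_0^\infty(B(x,r))$ with $|\partial^\alpha\varphi|\le r^{-n-|\alpha|}$ for $|\alpha|\le N$; and $f\in H^p(\Omega)$ means $\|f\|_{H^p(\Omega)}<\infty$. Then $H^{1,p}(\Omega)$ is the set of all locally integrable $u\in L^p(\Omega)$ whose distributional derivatives $D_1u,\dots,D_nu$ belong to $H^p(\Omega)$, with the quasi-norm $\|u\|_{H^{1,p}(\Omega)}=\sum_{j=1}^n\|D_ju\|_{H^p(\Omega)}+\|u\|_{L^p(\Omega)}$. Then, for every such $N$, $$M^{1,p}_{ball}(\Omega)=M^{1,p}(\Omega)\qquad\text{and}\qquad H^{1,p}(\Omega)=M^{1,p}(\Omega),$$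 in both cases with equivalent quasi-norms. -/

import Mathlib

open MeasureTheory TopologicalSpace
open scoped ENNReal NNReal Distributions LineDeriv

noncomputable section

namespace HardySobolev

/-- The Euclidean space of dimension `n`. -/
abbrev Eucl (n : ℕ) : Type := EuclideanSpace ℝ (Fin n)

variable {n : ℕ}

/-- The distance from `x` to the boundary of `Ω`; it is `∞` if the boundary is empty,
that is, if `Ω` is the whole space. -/
def bdryDist (Ω : Opens (Eucl n)) (x : Eucl n) : ℝ≥0∞ :=
  Metric.infEDist x (frontier (Ω : Set (Eucl n)))

/-- Uniform domains: nonempty connected open sets in which any two points `x`, `y` are joined by a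
rectifiable path, parametrized by arclength on `[0, T]`, of length `T ≤ c |x - y|`, that satisfies
the cigar condition. -/
def IsUniformDomain (Ω : Opens (Eucl n)) : Prop :=
  IsConnected (Ω : Set (Eucl n)) ∧
  ∃ c : ℝ, 0 < c ∧ ∀ x ∈ Ω, ∀ y ∈ Ω, ∃ (T : ℝ) (γ : ℝ → Eucl n), 0 ≤ T ∧
    Set.MapsTo γ (Set.Icc 0 T) (Ω : Set (Eucl n)) ∧ HasUnitSpeedOn γ (Set.Icc 0 T) ∧
    γ 0 = x ∧ γ T = y ∧ T ≤ c * dist x y ∧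
    ∀ t ∈ Set.Ioo 0 T, Metric.ball (γ t) (c⁻¹ * min t (T - t)) ⊆ (Ω : Set (Eucl n))

/-- The quasi-norm of the Lebesgue space `L^p(Ω)`, for functions with values in `ℝ` or `[0, ∞]`. -/
def lpNorm {ε : Type*} [ENorm ε] (Ω : Opens (Eucl n)) (p : ℝ) (u : Eucl n → ε) : ℝ≥0∞ :=
  eLpNorm u (ENNReal.ofReal p) (volume.restrict (Ω : Set (Eucl n)))

/-- `u ∈ L^p(Ω)`. Elements of function spaces on `Ω` are represented by functions on the whole
space, whose values outside `Ω` play no role. -/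
def MemLpOn (Ω : Opens (Eucl n)) (p : ℝ) (u : Eucl n → ℝ) : Prop :=
  MemLp u (ENNReal.ofReal p) (volume.restrict (Ω : Set (Eucl n)))

/-! ### Pointwise (Hajlasz type) Sobolev spaces -/

/-- `|u(x) - u(y)| ≤ |x - y| (g(x) + g(y))` for all `x`, `y` in `Ω` outside a null set. -/
def IsGrad (Ω : Opens (Eucl n)) (u g : Eucl n → ℝ) : Prop :=
  ∃ F : Set (Eucl n), volume F = 0 ∧
    ∀ x ∈ (Ω : Set (Eucl n)) \ F, ∀ y ∈ (Ω : Set (Eucl n)) \ F,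
      |u x - u y| ≤ dist x y * (g x + g y)

/-- The same inequality, required only if `|x - y| ≤ (1/4) min (d(x, ∂Ω), d(y, ∂Ω))`. -/
def IsBallGrad (Ω : Opens (Eucl n)) (u g : Eucl n → ℝ) : Prop :=
  ∃ F : Set (Eucl n), volume F = 0 ∧
    ∀ x ∈ (Ω : Set (Eucl n)) \ F, ∀ y ∈ (Ω : Set (Eucl n)) \ F,
      edist x y ≤ min (bdryDist Ω x) (bdryDist Ω y) / 4 →
        |u x - u y| ≤ dist x y * (g x + g y)

/-- The space `M^{1,p}(Ω)`. -/
def spaceM (Ω : Opens (Eucl n)) (p : ℝ) : Set (Eucl n → ℝ) :=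
  {u | MemLpOn Ω p u ∧ ∃ g, MemLpOn Ω p g ∧ IsGrad Ω u g}

/-- The quasi-norm of `M^{1,p}(Ω)`. -/
def normM (Ω : Opens (Eucl n)) (p : ℝ) (u : Eucl n → ℝ) : ℝ≥0∞ :=
  (⨅ (g : Eucl n → ℝ) (_ : MemLpOn Ω p g) (_ : IsGrad Ω u g), lpNorm Ω p g) + lpNorm Ω p u

/-- The space `M^{1,p}_{ball}(Ω)`. -/
def spaceMBall (Ω : Opens (Eucl n)) (p : ℝ) : Set (Eucl n → ℝ) :=
  {u | MemLpOn Ω p u ∧ ∃ g, MemLpOn Ω p g ∧ IsBallGrad Ω u g}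

/-- The quasi-norm of `M^{1,p}_{ball}(Ω)`. -/
def normMBall (Ω : Opens (Eucl n)) (p : ℝ) (u : Eucl n → ℝ) : ℝ≥0∞ :=
  (⨅ (g : Eucl n → ℝ) (_ : MemLpOn Ω p g) (_ : IsBallGrad Ω u g), lpNorm Ω p g) + lpNorm Ω p u

/-! ### Hardy spaces and Hardy-Sobolev spaces on `Ω` -/

/-- Normalized test functions at scale `r`: smooth functions `φ` with compact support in the open
ball `B(x, r)` such that `|∂^α φ| ≤ r^{-n-|α|}` for all `|α| ≤ N`. The derivative `∂^α` of order
`k = |α|` is written as the `k`-th derivative in the coordinate directions `a 0, …, a (k - 1)`. -/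
def IsNormalizedTest (Ω : Opens (Eucl n)) (N : ℕ) (x : Eucl n) (r : ℝ) (φ : 𝓓(Ω, ℝ)) : Prop :=
  tsupport φ ⊆ Metric.ball x r ∧
  ∀ k ≤ N, ∀ (a : Fin k → Fin n) (y : Eucl n),
    |iteratedFDeriv ℝ k φ y (fun i => EuclideanSpace.single (a i) (1 : ℝ))| ≤ (r ^ (n + k))⁻¹

/-- The grand maximal function of a distribution `T` on `Ω`, at the point `x`, over the test
functions at the scales `0 < r ≤ R`. -/
def grandMaximal (Ω : Opens (Eucl n)) (N : ℕ) (R : ℝ≥0∞) (T : 𝓓'(Ω, ℝ)) (x : Eucl n) : ℝ≥0∞ :=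
  ⨆ (r : ℝ) (_ : 0 < r) (_ : ENNReal.ofReal r ≤ R) (φ : 𝓓(Ω, ℝ))
    (_ : IsNormalizedTest Ω N x r φ), ‖T φ‖ₑ

/-- The quasi-norm of the Hardy space `H^p(Ω)`, defined by means of the grand maximal function at
the scales up to `d(x, ∂Ω)/2`. -/
def hardyNorm (Ω : Opens (Eucl n)) (p : ℝ) (N : ℕ) (T : 𝓓'(Ω, ℝ)) : ℝ≥0∞ :=
  lpNorm Ω p (fun x => grandMaximal Ω N (bdryDist Ω x / 2) T x)

/-- The Hardy space `H^p(Ω)`. -/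
def hardySpace (Ω : Opens (Eucl n)) (p : ℝ) (N : ℕ) : Set 𝓓'(Ω, ℝ) :=
  {T | hardyNorm Ω p N T < ∞}

/-- The distribution `φ ↦ ∫ φ u` on `Ω` given by a function `u` that is locally integrable
on `Ω`. -/
def toDistribution (Ω : Opens (Eucl n)) (u : Eucl n → ℝ) : 𝓓'(Ω, ℝ) :=
  UniformConvergenceCLM.ofFun (RingHom.id ℝ) ℝ {S : Set 𝓓(Ω, ℝ) | IsCompact S}
    (TestFunction.integralAgainstBilinCLM (ContinuousLinearMap.mul ℝ ℝ) volume u)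

theorem toDistribution_apply (Ω : Opens (Eucl n)) (u : Eucl n → ℝ)
    (hu : LocallyIntegrableOn u (Ω : Set (Eucl n)) volume) (φ : 𝓓(Ω, ℝ)) :
    toDistribution Ω u φ = ∫ x, φ x * u x :=
  TestFunction.integralAgainstBilinCLM_eq_integral hu

/-- The distributional partial derivative `D_j u` on `Ω` of a locally integrable function `u`. -/
def partialDeriv (Ω : Opens (Eucl n)) (j : Fin n) (u : Eucl n → ℝ) : 𝓓'(Ω, ℝ) :=
  ∂_{(EuclideanSpace.single j (1 : ℝ) : Eucl n)} (toDistribution Ω u)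

theorem partialDeriv_apply (Ω : Opens (Eucl n)) (j : Fin n) (u : Eucl n → ℝ)
    (hu : LocallyIntegrableOn u (Ω : Set (Eucl n)) volume) (φ : 𝓓(Ω, ℝ)) :
    partialDeriv Ω j u φ =
      -∫ x, fderiv ℝ φ x (EuclideanSpace.single j (1 : ℝ)) * u x := by
  rw [partialDeriv, Distribution.lineDerivOp_apply_apply, map_neg, toDistribution_apply Ω u hu]
  congr 2

/-- The Hardy-Sobolev space `H^{1,p}(Ω)`. -/
def spaceH (Ω : Opens (Eucl n)) (p : ℝ) (N : ℕ) : Set (Eucl n → ℝ) :=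
  {u | LocallyIntegrableOn u (Ω : Set (Eucl n)) volume ∧ MemLpOn Ω p u ∧
    ∀ j : Fin n, partialDeriv Ω j u ∈ hardySpace Ω p N}

/-- The quasi-norm of `H^{1,p}(Ω)`. -/
def normH (Ω : Opens (Eucl n)) (p : ℝ) (N : ℕ) (u : Eucl n → ℝ) : ℝ≥0∞ :=
  (∑ j : Fin n, hardyNorm Ω p N (partialDeriv Ω j u)) + lpNorm Ω p u

end HardySobolev

end

namespace HardySobolev

/-! Three estimates close a cycle: a pointwise gradient on `Ω` bounds the Hardy norms of the
derivatives, the Hardy norms produce a gradient for pairs that are close relative to the boundary,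
and on a uniform domain such a local gradient improves to a global one. The inclusion of `M^{1,p}`
in `M^{1,p}_{ball}` is trivial.

From `M` to `H`: fix `q` with `n/(n+1) < q < p`. Telescoping over points in shrinking balls gives a
Poincaré inequality (`exists_poincare_const`): on `B(x,r)` the mean oscillation of `u` is at most a
constant times `r` times the `L^q` mean of the gradient `G` on `B(x,2r)`. Derivatives of test
functions have integral zero, so `⟨D_j u, φ⟩` only sees this oscillation, and the grand maximal
function is at most a constant times `(M(G^q))^{1/q}`. As `p/q > 1`, the Hardy-Littlewood theorem
bounds its `L^p` norm. The Poincaré inequality with exponent `p` itself also shows that `u` is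
locally integrable.

From `H` to `M_ball`: let `η_τ` be the dilation of a bump `η` of integral one, centred at `x`. The
derivative of `η_τ` in `τ` is minus a divergence of test functions at scale `τ`, so `∫ η_τ u` has
`τ`-derivative at most a constant times the sum `S(x)` of the grand maximal functions. Integrating
from `0`, where the limit is `u(x)` at a Lebesgue point, gives `|∫ η_r u - u(x)| ≤ K r S(x)`.
Translating `η` makes the mollifiers for `x` and `y` coincide when `r = |x - y|`; hence a constant
multiple of `S` is a gradient at small scales (`exists_edist_le_grandMaximal`). Any open set will do
here.

From `M_ball` to `M`: each half of the curve joining `x` to `y` carries balls with radii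
proportional to the distance along the curve to its endpoint. In each ball choose a point where `G`
is at most its `L^q` mean, which is at most a constant times `(M(G^q))^{1/q}` at the endpoint; the
increments of `u` form a geometric series (`edist_le_maximalFn_of_cigar`). -/

variable {n : ℕ}

/-! ### Hardy-Littlewood maximal theorem -/

/-- The centred Hardy-Littlewood maximal function. -/
noncomputable def maximalFn (f : Eucl n → ℝ≥0∞) (x : Eucl n) : ℝ≥0∞ :=
  ⨆ (r : ℝ) (_ : 0 < r), (∫⁻ z in Metric.ball x r, f z) / volume (Metric.ball x r)

theorem volume_ball_eq (x : Eucl n) {r : ℝ} (hr : 0 < r) :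
    volume (Metric.ball x r) = ENNReal.ofReal (r ^ n) * volume (Metric.ball (0 : Eucl n) 1) := by
  rw [Measure.addHaar_ball_of_pos _ _ hr, finrank_euclideanSpace_fin]

theorem volume_ball_ne_zero (x : Eucl n) {r : ℝ} (hr : 0 < r) :
    volume (Metric.ball x r) ≠ 0 :=
  (Metric.measure_ball_pos volume x hr).ne'

theorem volume_ball_ne_top (x : Eucl n) (r : ℝ) : volume (Metric.ball x r) ≠ ∞ :=
  measure_ball_lt_top.ne

theorem setLIntegral_ball_le_maximalFn (f : Eucl n → ℝ≥0∞) (x : Eucl n) {r : ℝ} (hr : 0 < r) :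
    ∫⁻ z in Metric.ball x r, f z ≤ volume (Metric.ball x r) * maximalFn f x := by
  have h : (∫⁻ z in Metric.ball x r, f z) / volume (Metric.ball x r) ≤ maximalFn f x :=
    le_iSup₂ (f := fun (r : ℝ) (_ : 0 < r) =>
      (∫⁻ z in Metric.ball x r, f z) / volume (Metric.ball x r)) r hr
  rw [mul_comm]
  exact (ENNReal.div_le_iff (volume_ball_ne_zero x hr) (volume_ball_ne_top x r)).1 h

/-- An open ball is the increasing union of slightly smaller concentric ones, and each of these lies
in `B(y, r)` once `y` is close to `x`. Continuity from below of the measure with density `f` needs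
no measurability of `f`. -/
theorem lowerSemicontinuous_setLIntegral_ball (f : Eucl n → ℝ≥0∞) (r : ℝ) :
    LowerSemicontinuous fun x => ∫⁻ z in Metric.ball x r, f z := by
  intro x a ha
  have hmono : Monotone fun k : ℕ => Metric.ball x (r - 1 / ((k : ℝ) + 1)) := fun i j hij =>
    Metric.ball_subset_ball (by
      have : (1 : ℝ) / ((j : ℝ) + 1) ≤ 1 / ((i : ℝ) + 1) :=
        one_div_le_one_div_of_le (by positivity) (by exact_mod_cast Nat.succ_le_succ hij)
      linarith)
  have hU : Metric.ball x r = ⋃ k : ℕ, Metric.ball x (r - 1 / ((k : ℝ) + 1)) := by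
    ext z
    simp only [Set.mem_iUnion, Metric.mem_ball]
    constructor
    · intro hz
      obtain ⟨k, hk⟩ := exists_nat_one_div_lt (sub_pos.2 hz)
      exact ⟨k, by linarith⟩
    · rintro ⟨k, hk⟩
      have : (0 : ℝ) < 1 / ((k : ℝ) + 1) := by positivity
      linarith
  have hlim : Filter.Tendsto
      (fun k : ℕ => ∫⁻ z in Metric.ball x (r - 1 / ((k : ℝ) + 1)), f z) Filter.atTop
      (nhds (∫⁻ z in Metric.ball x r, f z)) := by
    simp only [← withDensity_apply f Metric.isOpen_ball.measurableSet]
    rw [hU]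
    exact tendsto_measure_iUnion_atTop hmono
  obtain ⟨k, hk⟩ := (hlim.eventually (lt_mem_nhds ha)).exists
  have hpos : (0 : ℝ) < 1 / ((k : ℝ) + 1) := by positivity
  filter_upwards [Metric.ball_mem_nhds x hpos] with y hy
  refine hk.trans_le (lintegral_mono_set (Metric.ball_subset_ball' ?_))
  rw [Metric.mem_ball, dist_comm] at hy
  linarith

theorem measurable_maximalFn (f : Eucl n → ℝ≥0∞) : Measurable (maximalFn f) := by
  have : LowerSemicontinuous (maximalFn f) := by
    refine lowerSemicontinuous_biSup fun r hr => ?_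
    intro x a ha
    have hv : ∀ y : Eucl n, volume (Metric.ball y r) = volume (Metric.ball x r) := fun y => by
      rw [volume_ball_eq _ hr, volume_ball_eq _ hr]
    replace ha := (ENNReal.lt_div_iff_mul_lt (.inl (volume_ball_ne_zero x hr))
      (.inl (volume_ball_ne_top x r))).1 ha
    filter_upwards [lowerSemicontinuous_setLIntegral_ball f r x _ ha] with y hy
    refine (ENNReal.lt_div_iff_mul_lt (.inl (volume_ball_ne_zero y hr))
      (.inl (volume_ball_ne_top y r))).2 ?_
    rw [hv y]
    exact hy
  exact this.measurable

/-- Vitali covering: balls on which the mean of `f` exceeds `l` have a disjoint subfamily whose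
fourfold enlargements cover the level set, whence the factor `4 ^ n`. -/
theorem maximalFn_weak_type (hn : 1 ≤ n) (f : Eucl n → ℝ≥0∞) {l : ℝ≥0∞} (hl : l ≠ ∞) :
    l * volume {x | l < maximalFn f x} ≤ 4 ^ n * ∫⁻ z, f z := by
  classical
  rcases eq_or_ne l 0 with rfl | hl0
  · simp
  rcases eq_or_ne (∫⁻ z, f z) ∞ with hf | hf
  · rw [hf, ENNReal.mul_top (by positivity)]; exact le_top
  set S := {x | l < maximalFn f x}
  have hr : ∀ x : S, ∃ r : ℝ, 0 < r ∧
      l * volume (Metric.ball (x : Eucl n) r) < ∫⁻ z in Metric.ball (x : Eucl n) r, f z := by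
    rintro ⟨x, hx⟩
    simp only [S, Set.mem_ofPred_eq, maximalFn, lt_iSup_iff] at hx
    obtain ⟨r, hr, h⟩ := hx
    exact ⟨r, hr, (ENNReal.lt_div_iff_mul_lt (.inl (volume_ball_ne_zero x hr))
      (.inl (volume_ball_ne_top x r))).1 h⟩
  choose r hr0 hr using hr
  set w := volume (Metric.ball (0 : Eucl n) 1)
  have hw0 : w ≠ 0 := volume_ball_ne_zero _ one_pos
  have hwt : w ≠ ∞ := volume_ball_ne_top _ _
  -- Vitali needs bounded radii. A selected ball with `r ≥ 1` satisfies `r ≤ r ^ n ≤ (∫ f) / (l w)`;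
  -- the first inequality uses `n ≥ 1`.
  set R : ℝ := max 1 ((∫⁻ z, f z) / (l * w)).toReal
  have hR : ∀ a ∈ (Set.univ : Set S), r a ≤ R := by
    intro a _
    rcases le_total (r a) 1 with h1 | h1
    · exact h1.trans (le_max_left _ _)
    refine le_trans ?_ (le_max_right _ _)
    have hlw : l * w ≠ 0 := mul_ne_zero hl0 hw0
    have hlwt : l * w ≠ ∞ := ENNReal.mul_ne_top hl hwt
    refine (ENNReal.ofReal_le_iff_le_toReal (ENNReal.div_ne_top hf hlw)).1 ?_
    rw [ENNReal.le_div_iff_mul_le (.inl hlw) (.inl hlwt)]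
    calc ENNReal.ofReal (r a) * (l * w) ≤ ENNReal.ofReal (r a ^ n) * (l * w) := by
          gcongr
          exact le_self_pow₀ h1 (by omega)
      _ = l * volume (Metric.ball (a : Eucl n) (r a)) := by
          rw [volume_ball_eq _ (hr0 a)]; ring
      _ ≤ ∫⁻ z, f z := (hr a).le.trans (setLIntegral_le_lintegral _ _)
  obtain ⟨u, -, hu, hcov⟩ := Vitali.exists_disjoint_subfamily_covering_enlargement_ball
    (Set.univ : Set S) (fun a => (a : Eucl n)) r R hR 4 (by norm_num)
  have huc : u.Countable := hu.countable_of_isOpen (fun _ _ => Metric.isOpen_ball)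
    fun a _ => ⟨a, Metric.mem_ball_self (hr0 a)⟩
  have hS : S ⊆ ⋃ b ∈ u, Metric.ball (b : Eucl n) (4 * r b) := by
    intro x hx
    obtain ⟨b, hb, hsub⟩ := hcov ⟨x, hx⟩ trivial
    exact Set.mem_biUnion hb (hsub (Metric.mem_ball_self (hr0 ⟨x, hx⟩)))
  have := huc.to_subtype
  calc l * volume S ≤ l * ∑' b : u, volume (Metric.ball ((b : S) : Eucl n) (4 * r b)) := by
        gcongr
        exact (measure_mono hS).trans (measure_biUnion_le _ huc _)
    _ = 4 ^ n * ∑' b : u, l * volume (Metric.ball ((b : S) : Eucl n) (r b)) := by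
        rw [ENNReal.tsum_mul_left, mul_left_comm, ← ENNReal.tsum_mul_left (a := 4 ^ n)]
        congr 2
        funext b
        rw [volume_ball_eq _ (hr0 b), volume_ball_eq _ (mul_pos four_pos (hr0 b)), mul_pow,
          ENNReal.ofReal_mul (by positivity), ENNReal.ofReal_pow (by norm_num)]
        norm_num [mul_assoc]
    _ ≤ 4 ^ n * ∑' b : u, ∫⁻ z in Metric.ball ((b : S) : Eucl n) (r b), f z := by
        gcongr with b
        exact (hr b).le
    _ = 4 ^ n * ∫⁻ z in ⋃ b ∈ u, Metric.ball (b : Eucl n) (r b), f z := by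
        rw [lintegral_biUnion huc (fun _ _ => measurableSet_ball) hu]
    _ ≤ 4 ^ n * ∫⁻ z, f z := by
        gcongr
        exact Measure.restrict_le_self

/-- The part of `f` where `2 f ≤ l` contributes at most `l / 2` to any mean, so the rest must have
maximal function above `l / 2` wherever that of `f` exceeds `l`. -/
theorem maximalFn_weak_type_truncated (hn : 1 ≤ n) {f : Eucl n → ℝ≥0∞} (hf : Measurable f)
    {l : ℝ≥0∞} (hl : l ≠ ∞) :
    l * volume {x | l < maximalFn f x} ≤ 2 * 4 ^ n * ∫⁻ z in {z | l < 2 * f z}, f z := by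
  have hA : MeasurableSet {z | l < 2 * f z} := measurableSet_lt measurable_const (by fun_prop)
  have key : {x | l < maximalFn f x} ⊆
      {x | l / 2 < maximalFn ({z | l < 2 * f z}.indicator f) x} := by
    intro x hx
    simp only [Set.mem_ofPred_eq, maximalFn, lt_iSup_iff] at hx ⊢
    obtain ⟨r, hr, h⟩ := hx
    refine ⟨r, hr, ?_⟩
    have h0 := volume_ball_ne_zero x hr
    have ht := volume_ball_ne_top x r
    rw [ENNReal.lt_div_iff_mul_lt (.inl h0) (.inl ht)] at h ⊢
    have h1 : ∫⁻ z in Metric.ball x r, f z ≤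
        (∫⁻ z in Metric.ball x r, {z | l < 2 * f z}.indicator f z) +
          l / 2 * volume (Metric.ball x r) := by
      rw [← setLIntegral_const, ← lintegral_add_right _ measurable_const]
      refine lintegral_mono fun z => ?_
      by_cases hz : l < 2 * f z
      · rw [Set.indicator_of_mem (show z ∈ {z | l < 2 * f z} from hz)]
        exact le_self_add
      · rw [Set.indicator_of_notMem (show z ∉ {z | l < 2 * f z} from hz), zero_add,
          ENNReal.le_div_iff_mul_le (by simp) (by simp), mul_comm]
        exact not_lt.1 hz
    have h2 : l * volume (Metric.ball x r) =
        l / 2 * volume (Metric.ball x r) + l / 2 * volume (Metric.ball x r) := by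
      rw [← add_mul, ENNReal.add_halves]
    rw [h2] at h
    have h3 : l / 2 * volume (Metric.ball x r) ≠ ∞ :=
      ENNReal.mul_ne_top (ENNReal.div_ne_top hl (by simp)) ht
    exact (ENNReal.add_lt_add_iff_right h3).1 (h.trans_le h1)
  calc l * volume {x | l < maximalFn f x}
      = 2 * (l / 2 * volume {x | l < maximalFn f x}) := by
        rw [← mul_assoc, show 2 * (l / 2) = l from ENNReal.mul_div_cancel two_ne_zero (by simp)]
    _ ≤ 2 * (l / 2 * volume {x | l / 2 < maximalFn ({z | l < 2 * f z}.indicator f) x}) := by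
        gcongr
    _ ≤ 2 * (4 ^ n * ∫⁻ z, {z | l < 2 * f z}.indicator f z) := by
        refine mul_le_mul_right ?_ _
        exact maximalFn_weak_type hn _ (ENNReal.div_ne_top hl (two_ne_zero))
    _ = _ := by rw [lintegral_indicator hA, mul_assoc]

theorem setLIntegral_Ioo_rpow {s a : ℝ} (hs : 0 < s) (ha : 0 ≤ a) :
    ∫⁻ t in Set.Ioo 0 a, ENNReal.ofReal (t ^ (s - 1)) = ENNReal.ofReal (a ^ s / s) := by
  have hint : IntervalIntegrable (fun t : ℝ => t ^ (s - 1)) volume 0 a :=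
    intervalIntegral.intervalIntegrable_rpow' (by linarith)
  rw [restrict_Ioo_eq_restrict_Ioc, ← ofReal_integral_eq_lintegral_ofReal,
    ← intervalIntegral.integral_of_le ha, integral_rpow (.inl (by linarith))]
  · rw [sub_add_cancel, Real.zero_rpow hs.ne', sub_zero]
  · exact (intervalIntegrable_iff_integrableOn_Ioc_of_le ha).1 hint
  · filter_upwards [ae_restrict_mem measurableSet_Ioc] with t ht
    exact Real.rpow_nonneg ht.1.le _

theorem lintegral_indicator_lt_rpow {s : ℝ} (hs : 0 < s) (a : ℝ≥0∞) :
    ∫⁻ t in Set.Ioi (0 : ℝ), {t : ℝ | ENNReal.ofReal t < a}.indicator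
      (fun t => ENNReal.ofReal (t ^ (s - 1))) t = a ^ s / ENNReal.ofReal s := by
  have hfin : ∀ b : ℝ, 0 ≤ b → ∫⁻ t in Set.Ioi (0 : ℝ),
      {t : ℝ | ENNReal.ofReal t < ENNReal.ofReal b}.indicator
      (fun t => ENNReal.ofReal (t ^ (s - 1))) t = ENNReal.ofReal b ^ s / ENNReal.ofReal s := by
    intro b hb
    rw [setLIntegral_indicator (measurableSet_lt (by fun_prop) measurable_const)]
    have : {t : ℝ | ENNReal.ofReal t < ENNReal.ofReal b} ∩ Set.Ioi 0 = Set.Ioo 0 b := by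
      ext t
      simp only [Set.mem_inter_iff, Set.mem_ofPred_eq, Set.mem_Ioi, Set.mem_Ioo]
      constructor
      · rintro ⟨h1, h2⟩
        exact ⟨h2, (ENNReal.ofReal_lt_ofReal_iff_of_nonneg h2.le).1 h1⟩
      · rintro ⟨h1, h2⟩
        exact ⟨(ENNReal.ofReal_lt_ofReal_iff_of_nonneg h1.le).2 h2, h1⟩
    rw [this, setLIntegral_Ioo_rpow hs hb, ENNReal.ofReal_div_of_pos hs,
      ENNReal.ofReal_rpow_of_nonneg hb hs.le]
  rcases eq_or_ne a ∞ with rfl | ha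
  · rw [ENNReal.top_rpow_of_pos hs, ENNReal.top_div_of_ne_top (by simp)]
    refine ENNReal.eq_top_of_forall_nnreal_le fun K => ?_
    -- Truncating at the level `(K s)^{1/s}` makes the integral exactly `K`, so for `a = ∞` it
    -- exceeds every finite bound.
    have hb : (0 : ℝ) ≤ (K * s) ^ (1 / s) := by positivity
    refine le_trans ?_ ((hfin _ hb).symm.le.trans (lintegral_mono fun t => ?_))
    · rw [ENNReal.ofReal_rpow_of_nonneg hb hs.le, ← Real.rpow_mul (by positivity),
        one_div_mul_cancel hs.ne', Real.rpow_one, ← ENNReal.ofReal_div_of_pos hs,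
        mul_div_cancel_right₀ _ hs.ne', ENNReal.ofReal_coe_nnreal]
    · exact Set.indicator_le_indicator_of_subset (fun t _ => ENNReal.ofReal_lt_top)
        (fun _ => zero_le) t
  · have := hfin a.toReal ENNReal.toReal_nonneg
    rwa [ENNReal.ofReal_toReal ha] at this

/-- Marcinkiewicz interpolation by hand: write the left side by the layer-cake formula, insert the
truncated weak-type bound, and exchange the integrals. The inner integral of `t^{s-2}` over `0 < t <
2 f(x)` converges because `s > 1`, and yields `(2 f(x))^{s-1} / (s-1)`. -/
theorem lintegral_maximalFn_rpow_le (hn : 1 ≤ n) {s : ℝ} (hs : 1 < s) :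
    ∃ C : ℝ≥0∞, C ≠ ∞ ∧ ∀ f : Eucl n → ℝ≥0∞, Measurable f →
      ∫⁻ x, maximalFn f x ^ s ≤ C * ∫⁻ x, f x ^ s := by
  have hs0 : 0 < s := by linarith
  have hs1 : 0 < s - 1 := by linarith
  refine ⟨ENNReal.ofReal s * (2 * 4 ^ n) * (2 ^ (s - 1) / ENNReal.ofReal (s - 1)), ?_, ?_⟩
  · refine ENNReal.mul_ne_top (ENNReal.mul_ne_top (by simp) ?_) (ENNReal.div_ne_top ?_ ?_)
    · exact ENNReal.mul_ne_top (by simp) (by finiteness)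
    · exact ENNReal.rpow_ne_top_of_nonneg hs1.le (by simp)
    · simpa using hs
  intro f hf
  have hM := measurable_maximalFn f
  have hm1 : MeasurableSet {q : Eucl n × ℝ | ENNReal.ofReal q.2 < maximalFn f q.1} :=
    measurableSet_lt (by fun_prop) (hM.comp measurable_fst)
  have hm2 : MeasurableSet {q : Eucl n × ℝ | ENNReal.ofReal q.2 < 2 * f q.1} :=
    measurableSet_lt (by fun_prop) (by fun_prop)
  have hg1 : Measurable fun t : ℝ => ENNReal.ofReal (t ^ (s - 1)) := by fun_prop
  have hg2 : Measurable fun t : ℝ => ENNReal.ofReal (t ^ (s - 1 - 1)) := by fun_prop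
  have e1 : ∫⁻ x, maximalFn f x ^ s = ENNReal.ofReal s * ∫⁻ t in Set.Ioi (0 : ℝ),
      ENNReal.ofReal (t ^ (s - 1)) * volume {x | ENNReal.ofReal t < maximalFn f x} := by
    have : ∀ x, maximalFn f x ^ s = ENNReal.ofReal s * ∫⁻ t in Set.Ioi (0 : ℝ),
        {t : ℝ | ENNReal.ofReal t < maximalFn f x}.indicator
          (fun t => ENNReal.ofReal (t ^ (s - 1))) t := fun x => by
      rw [lintegral_indicator_lt_rpow hs0, ENNReal.mul_div_cancel (by simpa using hs0) (by simp)]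
    simp_rw [this]
    have hmeas : Measurable (Function.uncurry fun (x : Eucl n) (t : ℝ) =>
        {t : ℝ | ENNReal.ofReal t < maximalFn f x}.indicator
          (fun t => ENNReal.ofReal (t ^ (s - 1))) t) :=
      (hg1.comp measurable_snd).indicator hm1
    rw [lintegral_const_mul' _ _ (by simp), lintegral_lintegral_swap hmeas.aemeasurable]
    congr 2
    ext t
    rw [show (fun x => {t : ℝ | ENNReal.ofReal t < maximalFn f x}.indicator
      (fun t => ENNReal.ofReal (t ^ (s - 1))) t) =
      {x | ENNReal.ofReal t < maximalFn f x}.indicator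
        (fun _ => ENNReal.ofReal (t ^ (s - 1))) from rfl,
      lintegral_indicator_const (measurableSet_lt measurable_const hM)]
  have e2 : ∀ t ∈ Set.Ioi (0 : ℝ),
      ENNReal.ofReal (t ^ (s - 1)) * volume {x | ENNReal.ofReal t < maximalFn f x} ≤
      2 * 4 ^ n * ∫⁻ x, {t : ℝ | ENNReal.ofReal t < 2 * f x}.indicator
        (fun t => ENNReal.ofReal (t ^ (s - 1 - 1))) t * f x := by
    intro t ht
    have ht : 0 < t := ht
    have h := maximalFn_weak_type_truncated hn hf (l := ENNReal.ofReal t) (by simp)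
    calc ENNReal.ofReal (t ^ (s - 1)) * volume {x | ENNReal.ofReal t < maximalFn f x}
        = ENNReal.ofReal (t ^ (s - 1 - 1)) *
          (ENNReal.ofReal t * volume {x | ENNReal.ofReal t < maximalFn f x}) := by
          rw [← mul_assoc, ← ENNReal.ofReal_mul (by positivity)]
          congr 2
          rw [Real.rpow_sub_one ht.ne' (s - 1), div_mul_cancel₀ _ ht.ne']
      _ ≤ ENNReal.ofReal (t ^ (s - 1 - 1)) *
          (2 * 4 ^ n * ∫⁻ z in {z | ENNReal.ofReal t < 2 * f z}, f z) := by gcongr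
      _ = _ := by
          rw [mul_left_comm, ← lintegral_indicator (measurableSet_lt measurable_const
            (by fun_prop)), ← lintegral_const_mul' _ _ (by simp)]
          congr 2
          ext x
          by_cases hx : ENNReal.ofReal t < 2 * f x
          · rw [Set.indicator_of_mem (show x ∈ {z | ENNReal.ofReal t < 2 * f z} from hx),
              Set.indicator_of_mem (show t ∈ {t : ℝ | ENNReal.ofReal t < 2 * f x} from hx)]
          · rw [Set.indicator_of_notMem (show x ∉ {z | ENNReal.ofReal t < 2 * f z} from hx),
              Set.indicator_of_notMem (show t ∉ {t : ℝ | ENNReal.ofReal t < 2 * f x} from hx)]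
            simp
  have hmeas2 : Measurable (Function.uncurry fun (t : ℝ) (x : Eucl n) =>
      {t : ℝ | ENNReal.ofReal t < 2 * f x}.indicator
        (fun t => ENNReal.ofReal (t ^ (s - 1 - 1))) t * f x) :=
    (((hg2.comp measurable_snd).indicator hm2).comp measurable_swap).mul
      (hf.comp measurable_snd)
  calc ∫⁻ x, maximalFn f x ^ s
      ≤ ENNReal.ofReal s * ∫⁻ t in Set.Ioi (0 : ℝ), 2 * 4 ^ n *
        ∫⁻ x, {t : ℝ | ENNReal.ofReal t < 2 * f x}.indicator
        (fun t => ENNReal.ofReal (t ^ (s - 1 - 1))) t * f x := by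
        rw [e1]
        refine mul_le_mul_right ?_ _
        exact setLIntegral_mono' measurableSet_Ioi e2
    _ = ENNReal.ofReal s * (2 * 4 ^ n) * ∫⁻ x, (∫⁻ t in Set.Ioi (0 : ℝ),
        {t : ℝ | ENNReal.ofReal t < 2 * f x}.indicator
        (fun t => ENNReal.ofReal (t ^ (s - 1 - 1))) t) * f x := by
        rw [lintegral_const_mul' _ _ (ENNReal.mul_ne_top (by simp) (by finiteness)),
          lintegral_lintegral_swap hmeas2.aemeasurable, ← mul_assoc]
        congr 2
        funext x
        rw [lintegral_mul_const _ (hg2.indicator (measurableSet_lt (by fun_prop)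
          measurable_const))]
    _ = ENNReal.ofReal s * (2 * 4 ^ n) * ∫⁻ x, 2 ^ (s - 1) / ENNReal.ofReal (s - 1) *
          f x ^ s := by
        congr 2
        ext x
        rw [lintegral_indicator_lt_rpow hs1, ENNReal.mul_rpow_of_nonneg _ _ hs1.le,
          ENNReal.div_eq_inv_mul, ENNReal.div_eq_inv_mul]
        have : f x ^ s = f x ^ (s - 1) * f x := by
          conv_rhs => rw [← ENNReal.rpow_one (f x), ← ENNReal.rpow_mul, one_mul,
            ← ENNReal.rpow_add_of_nonneg _ _ hs1.le zero_le_one, sub_add_cancel]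
        rw [this]; ring
    _ = _ := by
        rw [lintegral_const_mul' _ _ (ENNReal.div_ne_top
          (ENNReal.rpow_ne_top_of_nonneg hs1.le (by simp)) (by simpa using hs)), ← mul_assoc]

/-! ### Balls and the distance to the boundary -/

/-- The ball is connected, meets `Ω` at its centre and misses the frontier, so it cannot reach the
exterior of `Ω`. -/
theorem ball_subset_of_le_bdryDist {Ω : Opens (Eucl n)} {x : Eucl n} (hx : x ∈ Ω) {r : ℝ}
    (h : ENNReal.ofReal r ≤ bdryDist Ω x) : Metric.ball x r ⊆ (Ω : Set (Eucl n)) := by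
  rcases le_or_gt r 0 with hr | hr
  · simp [Metric.ball_eq_empty.2 hr]
  refine (convex_ball x r).isPreconnected.subset_left_of_subset_union Ω.isOpen
    (isClosed_closure (s := (Ω : Set (Eucl n)))).isOpen_compl
    (Set.disjoint_compl_right_iff_subset.2 subset_closure) ?_ ⟨x, Metric.mem_ball_self hr, hx⟩
  intro z hz
  by_contra hcon
  simp only [Set.mem_union, Set.mem_compl_iff, not_or, not_not] at hcon
  have hfr : z ∈ frontier (Ω : Set (Eucl n)) := by
    rw [Ω.isOpen.frontier_eq]; exact ⟨hcon.2, hcon.1⟩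
  have h1 := h.trans (Metric.infEDist_le_edist_of_mem hfr)
  rw [edist_dist, ENNReal.ofReal_le_ofReal_iff dist_nonneg] at h1
  rw [Metric.mem_ball, dist_comm] at hz
  linarith

theorem le_bdryDist_of_ball_subset {Ω : Opens (Eucl n)} {x : Eucl n} {r : ℝ}
    (h : Metric.ball x r ⊆ (Ω : Set (Eucl n))) : ENNReal.ofReal r ≤ bdryDist Ω x := by
  refine Metric.le_infEDist.2 fun y hy => ?_
  rw [Ω.isOpen.frontier_eq] at hy
  rw [edist_dist]
  refine ENNReal.ofReal_le_ofReal (le_of_not_gt fun hlt => hy.2 (h ?_))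
  rwa [Metric.mem_ball, dist_comm]

theorem bdryDist_le_edist_add (Ω : Opens (Eucl n)) (x y : Eucl n) :
    bdryDist Ω x ≤ edist x y + bdryDist Ω y :=
  Metric.infEDist_le_edist_add_infEDist

/-! ### Power means and the Poincaré inequality -/

/-- The `L^q` mean of `G` over the ball `B(x, r)`. -/
noncomputable def powerMean (q : ℝ) (G : Eucl n → ℝ≥0∞) (x : Eucl n) (r : ℝ) : ℝ≥0∞ :=
  ((∫⁻ z in Metric.ball x r, G z ^ q) / volume (Metric.ball x r)) ^ (1 / q)

/-- A function is somewhere at most its mean, even off a null set. These good points play the role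
of ball averages of `u`, whose integrability is not yet available. -/
theorem exists_mem_ball_le_powerMean {q : ℝ} (hq : 0 < q) {G : Eucl n → ℝ≥0∞} (hG : Measurable G)
    {F : Set (Eucl n)} (hF : volume F = 0) (x : Eucl n) {r : ℝ} (hr : 0 < r) :
    ∃ z ∈ Metric.ball x r, z ∉ F ∧ G z ≤ powerMean q G x r := by
  have hres : volume.restrict (Metric.ball x r \ F) = volume.restrict (Metric.ball x r) :=
    Measure.restrict_congr_set (sdiff_null_ae_eq_self hF)
  have hvol : volume (Metric.ball x r \ F) = volume (Metric.ball x r) := measure_sdiff_null hF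
  obtain ⟨z, hz, h⟩ := exists_le_setLAverage (μ := volume) (s := Metric.ball x r \ F)
    (f := fun z => G z ^ q) (by rw [hvol]; exact volume_ball_ne_zero x hr)
    (by rw [hvol]; exact volume_ball_ne_top x r) (hG.pow_const q).aemeasurable
  refine ⟨z, hz.1, hz.2, ?_⟩
  rw [setLAverage_eq, hres, hvol] at h
  calc G z = (G z ^ q) ^ (1 / q) := by
        rw [← ENNReal.rpow_mul, mul_one_div_cancel hq.ne', ENNReal.rpow_one]
    _ ≤ _ := ENNReal.rpow_le_rpow h (by positivity)

theorem lintegral_setLIntegral_ball {f : Eucl n → ℝ≥0∞} (hf : Measurable f) (r : ℝ) :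
    ∫⁻ x, ∫⁻ z in Metric.ball x r, f z = volume (Metric.ball (0 : Eucl n) r) * ∫⁻ z, f z := by
  have hm : MeasurableSet {w : Eucl n × Eucl n | dist w.2 w.1 < r} :=
    measurableSet_lt (by fun_prop) measurable_const
  have hmeas : Measurable (Function.uncurry fun (x z : Eucl n) =>
      (Metric.ball x r).indicator f z) :=
    (hf.comp measurable_snd).indicator hm
  simp_rw [← lintegral_indicator (f := f) measurableSet_ball]
  rw [lintegral_lintegral_swap hmeas.aemeasurable, ← lintegral_const_mul' _ _
    (volume_ball_ne_top 0 r)]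
  congr 1
  funext z
  have : (fun x => (Metric.ball x r).indicator f z) =
      (Metric.ball z r).indicator fun _ => f z := by
    funext x
    by_cases h : dist z x < r
    · rw [Set.indicator_of_mem (Metric.mem_ball.2 h), Set.indicator_of_mem]
      rwa [Metric.mem_ball, dist_comm]
    · rw [Set.indicator_of_notMem (by rwa [Metric.mem_ball]), Set.indicator_of_notMem]
      rwa [Metric.mem_ball, dist_comm]
  rw [this, lintegral_indicator_const measurableSet_ball, mul_comm]
  congr 1
  rw [Measure.addHaar_ball_center]

theorem measurable_powerMean (q : ℝ) (G : Eucl n → ℝ≥0∞) (r : ℝ) :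
    Measurable fun x => powerMean q G x r := by
  refine Measurable.pow_const ?_ _
  have : ∀ x : Eucl n, volume (Metric.ball x r) = volume (Metric.ball (0 : Eucl n) r) :=
    fun x => Measure.addHaar_ball_center _ _ _
  simp_rw [this]
  exact (lowerSemicontinuous_setLIntegral_ball _ r).measurable.div_const _

/-- Telescope along good points `y i` of the balls `B(x, r / 2^i)`, then pass from `y 0` to `z`. The
telescoping costs `6` and the last step `3`, hence the `9`. -/
theorem edist_le_tsum_powerMean {q : ℝ} (hq : 0 < q) {u : Eucl n → ℝ} {G : Eucl n → ℝ≥0∞}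
    (hG : Measurable G) (hGfin : ∀ x, G x ≠ ∞) {F : Set (Eucl n)} (hF : volume F = 0)
    {x₀ : Eucl n} {r : ℝ} (hr : 0 < r)
    (h : ∀ x ∈ Metric.ball x₀ (2 * r) \ F, ∀ y ∈ Metric.ball x₀ (2 * r) \ F,
      edist (u x) (u y) ≤ edist x y * (G x + G y))
    {A : ℝ≥0∞} {x z : Eucl n} (hx : x ∈ Metric.ball x₀ r \ F) (hz : z ∈ Metric.ball x₀ r \ F)
    (hzA : G z ≤ A) :
    edist (u x) (u z) ≤ ENNReal.ofReal r * (9 *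
      (∑' i : ℕ, (2⁻¹ : ℝ≥0∞) ^ i * powerMean q G x (r / 2 ^ i) + A)) := by
  set S := ∑' i : ℕ, (2⁻¹ : ℝ≥0∞) ^ i * powerMean q G x (r / 2 ^ i) with hS
  have hr' : ENNReal.ofReal r ≠ 0 := by simpa using hr
  rcases eq_or_ne S ∞ with hSt | hSt
  · rw [hSt, top_add, ENNReal.mul_top (by norm_num), ENNReal.mul_top hr']
    exact le_top
  have hρ : ∀ i : ℕ, 0 < r / 2 ^ i := fun i => by positivity
  choose y hy hyF hyG using fun i : ℕ => exists_mem_ball_le_powerMean hq hG hF x (hρ i)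
  have hρr : ∀ i : ℕ, r / 2 ^ i ≤ r := fun i =>
    div_le_self hr.le (one_le_pow₀ one_le_two)
  have hyB : ∀ i, y i ∈ Metric.ball x₀ (2 * r) \ F := fun i => by
    refine ⟨?_, hyF i⟩
    have h1 := Metric.mem_ball.1 (hy i)
    have h2 := Metric.mem_ball.1 hx.1
    have h3 := dist_triangle (y i) x x₀
    have h4 := hρr i
    rw [Metric.mem_ball]
    linarith
  have hball : Metric.ball x₀ r ⊆ Metric.ball x₀ (2 * r) :=
    Metric.ball_subset_ball (by linarith)
  have hofρ : ∀ i : ℕ, ENNReal.ofReal (r / 2 ^ i) = ENNReal.ofReal r * 2⁻¹ ^ i := fun i => by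
    rw [div_eq_mul_inv, ENNReal.ofReal_mul hr.le, ← inv_pow, ENNReal.ofReal_pow (by positivity),
      ENNReal.ofReal_inv_of_pos two_pos, ENNReal.ofReal_ofNat]
  set a : ℕ → ℝ≥0∞ := fun i => 2⁻¹ ^ i * powerMean q G x (r / 2 ^ i) with ha
  have hstep : ∀ i, edist (u (y i)) (u (y (i + 1))) ≤
      ENNReal.ofReal r * (2 * a i + 4 * a (i + 1)) := by
    intro i
    have hd : edist (y i) (y (i + 1)) ≤ ENNReal.ofReal r * (2 * 2⁻¹ ^ i) := by
      have h1 := Metric.mem_ball.1 (hy i)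
      have h2 := Metric.mem_ball'.1 (hy (i + 1))
      have h3 := dist_triangle (y i) x (y (i + 1))
      have h4 : r / 2 ^ (i + 1) ≤ r / 2 ^ i := by
        rw [pow_succ, ← div_div]
        exact half_le_self (hρ i).le
      rw [mul_left_comm, ← hofρ, edist_dist,
        show (2 : ℝ≥0∞) * ENNReal.ofReal (r / 2 ^ i) = ENNReal.ofReal (2 * (r / 2 ^ i)) by
          rw [ENNReal.ofReal_mul two_pos.le, ENNReal.ofReal_ofNat]]
      exact ENNReal.ofReal_le_ofReal (by linarith)
    calc edist (u (y i)) (u (y (i + 1)))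
        ≤ edist (y i) (y (i + 1)) * (G (y i) + G (y (i + 1))) := h _ (hyB i) _ (hyB (i + 1))
      _ ≤ ENNReal.ofReal r * (2 * 2⁻¹ ^ i) *
          (powerMean q G x (r / 2 ^ i) + powerMean q G x (r / 2 ^ (i + 1))) := by
          gcongr
          exacts [hyG i, hyG (i + 1)]
      _ = ENNReal.ofReal r * (2 * a i + 4 * a (i + 1)) := by
          have h2 : (4 : ℝ≥0∞) * 2⁻¹ ^ (i + 1) = 2 * 2⁻¹ ^ i := by
            rw [pow_succ, show (4 : ℝ≥0∞) = 2 * 2 by norm_num,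
              show (2 : ℝ≥0∞) * 2 * (2⁻¹ ^ i * 2⁻¹) = 2 * 2⁻¹ ^ i * (2 * 2⁻¹) by ring,
              ENNReal.mul_inv_cancel two_ne_zero (by simp), mul_one]
          simp only [ha]
          rw [← mul_assoc 4, h2]
          ring
  have ha0 : Filter.Tendsto a Filter.atTop (nhds 0) :=
    ENNReal.tendsto_atTop_zero_of_tsum_ne_top hSt
  -- No continuity of `u` is assumed: the gradient inequality for `y i` and `x` suffices, since `G
  -- x` is finite and the terms of the convergent series tend to zero.
  have hlim : Filter.Tendsto (fun i => u (y i)) Filter.atTop (nhds (u x)) := by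
    rw [tendsto_iff_edist_tendsto_0]
    have hb : Filter.Tendsto (fun i => ENNReal.ofReal r * (2⁻¹ ^ i * G x + a i)) Filter.atTop
        (nhds 0) := by
      have h1 : Filter.Tendsto (fun i : ℕ => (2⁻¹ : ℝ≥0∞) ^ i * G x) Filter.atTop (nhds 0) := by
        have := ENNReal.Tendsto.mul_const (b := G x)
          (ENNReal.tendsto_pow_atTop_nhds_zero_of_lt_one (r := 2⁻¹)
            (ENNReal.inv_lt_one.2 ENNReal.one_lt_two)) (.inr (hGfin x))
        rwa [zero_mul] at this
      have h2 := ENNReal.Tendsto.const_mul (a := ENNReal.ofReal r) (h1.add ha0)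
        (.inr ENNReal.ofReal_ne_top)
      rwa [add_zero, mul_zero] at h2
    refine tendsto_of_tendsto_of_tendsto_of_le_of_le tendsto_const_nhds hb
      (fun _ => zero_le) fun i => ?_
    have hd : edist (y i) x ≤ ENNReal.ofReal r * 2⁻¹ ^ i := by
      rw [← hofρ, edist_dist]
      exact ENNReal.ofReal_le_ofReal (Metric.mem_ball.1 (hy i)).le
    calc edist (u (y i)) (u x) ≤ edist (y i) x * (G (y i) + G x) :=
          h _ (hyB i) _ ⟨hball hx.1, hx.2⟩
      _ ≤ ENNReal.ofReal r * 2⁻¹ ^ i * (powerMean q G x (r / 2 ^ i) + G x) := by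
          gcongr
          exact hyG i
      _ = _ := by simp only [ha]; ring
  have hsum : edist (u (y 0)) (u x) ≤ ENNReal.ofReal r * (6 * S) := by
    refine (edist_le_tsum_of_edist_le_of_tendsto₀ _ hstep hlim).trans ?_
    rw [ENNReal.tsum_mul_left, ENNReal.tsum_add, ENNReal.tsum_mul_left, ENNReal.tsum_mul_left]
    have h1 : ∑' i, a (i + 1) ≤ S := by
      rw [hS, tsum_eq_zero_add' (f := a) ENNReal.summable]
      exact le_add_self
    calc ENNReal.ofReal r * (2 * ∑' i, a i + 4 * ∑' i, a (i + 1))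
        ≤ ENNReal.ofReal r * (2 * S + 4 * S) := by gcongr
      _ = _ := by ring
  have hend : edist (u (y 0)) (u z) ≤ ENNReal.ofReal r * (3 * (S + A)) := by
    have hd : edist (y 0) z ≤ ENNReal.ofReal r * 3 := by
      have h1 := Metric.mem_ball.1 (hy 0)
      have h2 := Metric.mem_ball.1 hx.1
      have h3 := Metric.mem_ball'.1 hz.1
      have h4 := dist_triangle4 (y 0) x x₀ z
      have h5 := hρr 0
      rw [edist_dist, show ENNReal.ofReal r * 3 = ENNReal.ofReal (r * 3) by
        rw [ENNReal.ofReal_mul hr.le, ENNReal.ofReal_ofNat]]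
      exact ENNReal.ofReal_le_ofReal (by linarith)
    have h0 : G (y 0) ≤ S := (hyG 0).trans (by
      have := ENNReal.le_tsum (f := a) 0
      simpa [ha] using this)
    calc edist (u (y 0)) (u z) ≤ edist (y 0) z * (G (y 0) + G z) :=
          h _ (hyB 0) _ ⟨hball hz.1, hz.2⟩
      _ ≤ ENNReal.ofReal r * 3 * (S + A) := by gcongr
      _ = _ := by ring
  calc edist (u x) (u z) ≤ edist (u (y 0)) (u x) + edist (u (y 0)) (u z) :=
        edist_triangle_left _ _ _
    _ ≤ ENNReal.ofReal r * (6 * S) + ENNReal.ofReal r * (3 * (S + A)) := add_le_add hsum hend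
    _ = ENNReal.ofReal r * (9 * S + 3 * A) := by ring
    _ ≤ ENNReal.ofReal r * (9 * S + 9 * A) := by gcongr; norm_num
    _ = _ := by ring

/-- Split `y^{1/q} = y^{1/q-1} y`. In the first factor the integral over the small ball is enlarged
to `B(x₀, 2r)`, which costs `2^{n(1/q-1)}` per halving of the radius; the second factor is linear in
`G^q` and is integrated by Tonelli. -/
theorem setLIntegral_powerMean_le {q : ℝ} (hq : 0 < q) (hq1 : q ≤ 1) {G : Eucl n → ℝ≥0∞}
    (hG : Measurable G) (x₀ : Eucl n) {r : ℝ} (hr : 0 < r) (i : ℕ) :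
    ∫⁻ x in Metric.ball x₀ r, powerMean q G x (r / 2 ^ i) ≤
      (2 ^ ((n : ℝ) * (1 / q - 1))) ^ i * (volume (Metric.ball x₀ r) *
      ((∫⁻ z in Metric.ball x₀ (2 * r), G z ^ q) / volume (Metric.ball x₀ r)) ^ (1 / q)) := by
  set I := ∫⁻ z in Metric.ball x₀ (2 * r), G z ^ q with hI
  set V := volume (Metric.ball x₀ r)
  have hV0 : V ≠ 0 := volume_ball_ne_zero x₀ hr
  have hVt : V ≠ ∞ := volume_ball_ne_top x₀ r
  have hρ : 0 < r / 2 ^ i := by positivity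
  set W := volume (Metric.ball (0 : Eucl n) (r / 2 ^ i)) with hW
  have hW0 : W ≠ 0 := volume_ball_ne_zero _ hρ
  have hWt : W ≠ ∞ := volume_ball_ne_top _ _
  have he : 0 ≤ 1 / q - 1 := by
    rw [sub_nonneg, le_div_iff₀ hq]; linarith
  have hVW : V = (2 ^ n) ^ i * W := by
    simp only [V, W]
    rw [volume_ball_eq _ hr, volume_ball_eq _ hρ, ← mul_assoc]
    congr 1
    rw [show ((2 : ℝ≥0∞) ^ n) ^ i = ENNReal.ofReal ((2 ^ n) ^ i) by
      rw [ENNReal.ofReal_pow (by positivity), ENNReal.ofReal_pow (by positivity),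
        ENNReal.ofReal_ofNat], ← ENNReal.ofReal_mul (by positivity), div_pow, ← pow_mul, ← pow_mul,
      mul_comm i n]
    field_simp
  have hsub : ∀ x ∈ Metric.ball x₀ r, Metric.ball x (r / 2 ^ i) ⊆ Metric.ball x₀ (2 * r) := by
    intro x hx
    refine Metric.ball_subset_ball' ?_
    have h1 := Metric.mem_ball.1 hx
    have h2 : r / 2 ^ i ≤ r := div_le_self hr.le (one_le_pow₀ one_le_two)
    linarith
  have hrp : ∀ y : ℝ≥0∞, y ^ (1 / q) = y ^ (1 / q - 1) * y := fun y => by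
    conv_rhs => rw [← ENNReal.rpow_one y, ← ENNReal.rpow_mul, one_mul,
      ← ENNReal.rpow_add_of_nonneg _ _ he zero_le_one, sub_add_cancel]
  have hpt : ∀ x ∈ Metric.ball x₀ r, powerMean q G x (r / 2 ^ i) ≤
      (I / W) ^ (1 / q - 1) * W⁻¹ * ∫⁻ z in Metric.ball x (r / 2 ^ i),
        (Metric.ball x₀ (2 * r)).indicator (fun z => G z ^ q) z := by
    intro x hx
    have e : ∫⁻ z in Metric.ball x (r / 2 ^ i),
        (Metric.ball x₀ (2 * r)).indicator (fun z => G z ^ q) z =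
        ∫⁻ z in Metric.ball x (r / 2 ^ i), G z ^ q :=
      setLIntegral_congr_fun measurableSet_ball fun z hz =>
        Set.indicator_of_mem (hsub x hx hz) _
    rw [e, powerMean, hrp, Measure.addHaar_ball_center volume x, ← hW, mul_assoc,
      ENNReal.div_eq_inv_mul (a := ∫⁻ z in Metric.ball x (r / 2 ^ i), G z ^ q)]
    gcongr
    rw [← ENNReal.div_eq_inv_mul]
    gcongr
    exact lintegral_mono_set (hsub x hx)
  calc ∫⁻ x in Metric.ball x₀ r, powerMean q G x (r / 2 ^ i)
      ≤ ∫⁻ x in Metric.ball x₀ r, (I / W) ^ (1 / q - 1) * W⁻¹ *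
        ∫⁻ z in Metric.ball x (r / 2 ^ i),
        (Metric.ball x₀ (2 * r)).indicator (fun z => G z ^ q) z :=
        setLIntegral_mono' measurableSet_ball hpt
    _ ≤ ∫⁻ x, (I / W) ^ (1 / q - 1) * W⁻¹ * ∫⁻ z in Metric.ball x (r / 2 ^ i),
        (Metric.ball x₀ (2 * r)).indicator (fun z => G z ^ q) z := setLIntegral_le_lintegral _ _
    _ = (I / W) ^ (1 / q - 1) * W⁻¹ * (W * I) := by
        rw [lintegral_const_mul _ (lowerSemicontinuous_setLIntegral_ball _ _).measurable,
          lintegral_setLIntegral_ball ((hG.pow_const q).indicator measurableSet_ball),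
          lintegral_indicator measurableSet_ball]
    _ = (I / W) ^ (1 / q - 1) * I := by
        rw [mul_assoc, ← mul_assoc W⁻¹, ENNReal.inv_mul_cancel hW0 hWt, one_mul]
    _ = ((2 ^ n) ^ i * (I / V)) ^ (1 / q - 1) * (V * (I / V)) := by
        rw [ENNReal.mul_div_cancel hV0 hVt]
        congr 2
        rw [hVW, ENNReal.div_eq_inv_mul, ENNReal.div_eq_inv_mul,
          ENNReal.mul_inv (.inr hWt) (.inr hW0), ← mul_assoc, ← mul_assoc,
          ENNReal.mul_inv_cancel (by positivity) (by finiteness), one_mul]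
    _ = _ := by
        rw [ENNReal.mul_rpow_of_nonneg _ _ he, hrp, ENNReal.rpow_mul, ENNReal.rpow_natCast,
          ← ENNReal.rpow_natCast, ← ENNReal.rpow_natCast _ i, ← ENNReal.rpow_mul,
          ← ENNReal.rpow_mul, mul_comm (i : ℝ)]
        ring

theorem exists_poincare_const {q : ℝ} (hq : (n : ℝ) / (n + 1) < q) (hq1 : q ≤ 1) :
    ∃ C : ℝ≥0∞, C ≠ ∞ ∧ ∀ (u : Eucl n → ℝ) (G : Eucl n → ℝ≥0∞), Measurable G →
      (∀ x, G x ≠ ∞) → ∀ F : Set (Eucl n), volume F = 0 → ∀ (x₀ : Eucl n) (r : ℝ), 0 < r →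
      (∀ x ∈ Metric.ball x₀ (2 * r) \ F, ∀ y ∈ Metric.ball x₀ (2 * r) \ F,
        edist (u x) (u y) ≤ edist x y * (G x + G y)) →
      ∃ c : ℝ, ∫⁻ x in Metric.ball x₀ r, edist (u x) c ≤
        C * (ENNReal.ofReal r * (volume (Metric.ball x₀ r) *
        ((∫⁻ z in Metric.ball x₀ (2 * r), G z ^ q) / volume (Metric.ball x₀ r)) ^ (1 / q))) := by
  have hq0 : 0 < q := lt_of_le_of_lt (by positivity) hq
  -- The condition `q > n/(n+1)` is equivalent to `β < 1`. So the gain `2^{-i}` from the radii beats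
  -- the loss `2^{β i}` from the power means, and the series is geometric with ratio below one.
  set β := (n : ℝ) * (1 / q - 1)
  have hβ : β < 1 := by
    have h1 : (n : ℝ) < q * (n + 1) := (div_lt_iff₀ (by positivity)).1 hq
    have : β = (n - n * q) / q := by simp only [β]; field_simp
    rw [this, div_lt_one hq0]
    linarith
  have hθ : (2⁻¹ * 2 ^ β : ℝ≥0∞) < 1 := by
    rw [← ENNReal.rpow_neg_one, ← ENNReal.rpow_add _ _ two_ne_zero (by simp)]
    exact ENNReal.rpow_lt_one_of_one_lt_of_neg ENNReal.one_lt_two (by linarith)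
  refine ⟨9 * ((1 - 2⁻¹ * 2 ^ β)⁻¹ + 1), ?_, ?_⟩
  · refine ENNReal.mul_ne_top (by simp) (ENNReal.add_ne_top.2 ⟨?_, by simp⟩)
    exact ENNReal.inv_ne_top.2 (tsub_pos_of_lt hθ).ne'
  intro u G hG hGfin F hF x₀ r hr h
  set V := volume (Metric.ball x₀ r)
  set A := ((∫⁻ z in Metric.ball x₀ (2 * r), G z ^ q) / V) ^ (1 / q)
  obtain ⟨z, hz, hzF, hzG⟩ := exists_mem_ball_le_powerMean hq0 hG hF x₀ hr
  have hzA : G z ≤ A := hzG.trans (by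
    simp only [powerMean, A]
    gcongr
    linarith)
  refine ⟨u z, ?_⟩
  have hae : ∀ᵐ x ∂volume.restrict (Metric.ball x₀ r), edist (u x) (u z) ≤ ENNReal.ofReal r * (9 *
      (∑' i : ℕ, (2⁻¹ : ℝ≥0∞) ^ i * powerMean q G x (r / 2 ^ i) + A)) := by
    filter_upwards [ae_restrict_mem measurableSet_ball,
      ae_restrict_of_ae (compl_mem_ae_iff.2 hF)] with x hx hxF
    exact edist_le_tsum_powerMean hq0 hG hGfin hF hr h ⟨hx, hxF⟩ ⟨hz, hzF⟩ hzA
  have hm : ∀ i : ℕ, Measurable fun x : Eucl n =>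
      (2⁻¹ : ℝ≥0∞) ^ i * powerMean q G x (r / 2 ^ i) :=
    fun i => (measurable_powerMean q G _).const_mul _
  calc ∫⁻ x in Metric.ball x₀ r, edist (u x) (u z)
      ≤ ∫⁻ x in Metric.ball x₀ r, ENNReal.ofReal r * (9 *
      (∑' i : ℕ, (2⁻¹ : ℝ≥0∞) ^ i * powerMean q G x (r / 2 ^ i) + A)) := lintegral_mono_ae hae
    _ = ENNReal.ofReal r * (9 *
      (∑' i : ℕ, (2⁻¹ : ℝ≥0∞) ^ i * (∫⁻ x in Metric.ball x₀ r, powerMean q G x (r / 2 ^ i)) +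
        A * V)) := by
        rw [lintegral_const_mul' _ _ (by simp), lintegral_const_mul' _ _ (by simp),
          lintegral_add_right _ measurable_const, lintegral_tsum fun i => (hm i).aemeasurable,
          setLIntegral_const]
        simp_rw [lintegral_const_mul _ (measurable_powerMean q G _)]
        rfl
    _ ≤ ENNReal.ofReal r * (9 *
      (∑' i : ℕ, (2⁻¹ : ℝ≥0∞) ^ i * ((2 ^ β) ^ i * (V * A)) + A * V)) := by
        refine mul_le_mul_right (mul_le_mul_right (add_le_add_left (ENNReal.tsum_le_tsum fun i =>
          mul_le_mul_right (setLIntegral_powerMean_le hq0 hq1 hG x₀ hr i) _) _) _) _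
    _ = ENNReal.ofReal r * (9 *
      ((1 - 2⁻¹ * 2 ^ β)⁻¹ * (V * A) + A * V)) := by
        simp_rw [← mul_assoc, ← mul_pow]
        rw [ENNReal.tsum_mul_right, ENNReal.tsum_mul_right, ENNReal.tsum_geometric]
    _ = _ := by ring

/-! ### Chains of balls in a uniform domain -/

theorem powerMean_le_maximalFn {q : ℝ} (hq : 0 < q) (G : Eucl n → ℝ≥0∞) {x y : Eucl n} {r k : ℝ}
    (hr : 0 < r) (hk : 0 < k) (h : Metric.ball y r ⊆ Metric.ball x (k * r)) :
    powerMean q G y r ≤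
      ENNReal.ofReal (k ^ n) ^ (1 / q) * maximalFn (fun z => G z ^ q) x ^ (1 / q) := by
  rw [powerMean, ← ENNReal.mul_rpow_of_nonneg _ _ (by positivity)]
  gcongr
  rw [ENNReal.div_le_iff (volume_ball_ne_zero y hr) (volume_ball_ne_top y r)]
  calc ∫⁻ z in Metric.ball y r, G z ^ q ≤ ∫⁻ z in Metric.ball x (k * r), G z ^ q :=
        lintegral_mono_set h
    _ ≤ volume (Metric.ball x (k * r)) * maximalFn (fun z => G z ^ q) x :=
        setLIntegral_ball_le_maximalFn _ _ (by positivity)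
    _ = _ := by
        rw [volume_ball_eq x (by positivity), volume_ball_eq y hr, mul_pow,
          ENNReal.ofReal_mul (by positivity)]
        ring

theorem edist_le_min_bdryDist_div_four {Ω : Opens (Eucl n)} {x y : Eucl n} {R : ℝ}
    (hx : Metric.ball x R ⊆ (Ω : Set (Eucl n))) (hy : Metric.ball y R ⊆ (Ω : Set (Eucl n)))
    (h : dist x y ≤ R / 4) : edist x y ≤ min (bdryDist Ω x) (bdryDist Ω y) / 4 := by
  rw [ENNReal.le_div_iff_mul_le (.inl (by norm_num)) (.inl (by norm_num)), edist_dist]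
  have h1 : ENNReal.ofReal (dist x y) * 4 ≤ ENNReal.ofReal R := by
    rw [show ENNReal.ofReal (dist x y) * 4 = ENNReal.ofReal (dist x y * 4) by
      rw [ENNReal.ofReal_mul dist_nonneg, ENNReal.ofReal_ofNat]]
    exact ENNReal.ofReal_le_ofReal (by linarith)
  exact h1.trans (le_min (le_bdryDist_of_ball_subset hx) (le_bdryDist_of_ball_subset hy))

/-- The chain of balls along one half of the curve in the definition of a uniform domain. -/
theorem edist_le_maximalFn_of_cigar {Ω : Opens (Eucl n)} {q : ℝ} (hq : 0 < q) {u : Eucl n → ℝ}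
    {G : Eucl n → ℝ≥0∞} (hG : Measurable G) (hGfin : ∀ x, G x ≠ ∞) {F : Set (Eucl n)}
    (hF : volume F = 0)
    (h : ∀ x ∈ (Ω : Set (Eucl n)) \ F, ∀ y ∈ (Ω : Set (Eucl n)) \ F,
      edist x y ≤ min (bdryDist Ω x) (bdryDist Ω y) / 4 →
        edist (u x) (u y) ≤ edist x y * (G x + G y))
    {ε : ℝ} (hε : 0 < ε) (hε1 : 32 * ε ≤ 1) {x : Eucl n} (hx : x ∈ (Ω : Set (Eucl n)) \ F)
    {L : ℝ} (hL : 0 < L) {σ : ℝ → Eucl n} (hσ0 : σ 0 = x)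
    (hσ : ∀ s ∈ Set.Icc 0 L, ∀ t ∈ Set.Icc 0 L, dist (σ s) (σ t) ≤ |s - t|)
    (hσΩ : ∀ t ∈ Set.Ioc 0 L, Metric.ball (σ t) (32 * ε * t) ⊆ (Ω : Set (Eucl n)))
    {z : Eucl n} (hz : z ∈ Metric.ball (σ L) (ε * L)) (hzF : z ∉ F)
    (hzG : G z ≤ powerMean q G (σ L) (ε * L)) :
    edist (u x) (u z) ≤ ENNReal.ofReal (6 * L) * (ENNReal.ofReal ((2 / ε) ^ n) ^ (1 / q) *
      maximalFn (fun z => G z ^ q) x ^ (1 / q)) := by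
  set K := ENNReal.ofReal ((2 / ε) ^ n) ^ (1 / q) *
    maximalFn (fun z => G z ^ q) x ^ (1 / q) with hK
  rcases eq_or_ne K ∞ with hKt | hKt
  · rw [hKt, ENNReal.mul_top (by simpa using hL)]
    exact le_top
  -- The centres are `σ (L l^i)`. Neighbouring centres are at most `ε t i` apart, a small fraction
  -- of the room `32 ε t i` around them.
  set l := 1 - ε with hl
  have hl0 : 0 < l := by linarith
  have hl1 : l < 1 := by linarith
  set t : ℕ → ℝ := fun i => L * l ^ i with ht
  have ht0 : ∀ i, 0 < t i := fun i => by positivity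
  have htL : ∀ i, t i ≤ L := fun i =>
    mul_le_of_le_one_right hL.le (pow_le_one₀ hl0.le hl1.le)
  have hts : ∀ i, t (i + 1) = l * t i := fun i => by simp only [ht]; ring
  -- The chain starts at the prescribed `z`, so that the chains from both ends of the curve share
  -- this point.
  have hpt : ∀ i, ∃ y ∈ Metric.ball (σ (t i)) (ε * t i), (y ∉ F ∧
      G y ≤ powerMean q G (σ (t i)) (ε * t i)) ∧ (i = 0 → y = z) := by
    intro i
    rcases eq_or_ne i 0 with rfl | hi
    · have : t 0 = L := by simp [ht]
      rw [this]
      exact ⟨z, hz, ⟨hzF, hzG⟩, fun _ => rfl⟩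
    · obtain ⟨y, hy, hyF, hyG⟩ :=
        exists_mem_ball_le_powerMean hq hG hF (σ (t i)) (mul_pos hε (ht0 i))
      exact ⟨y, hy, ⟨hyF, hyG⟩, fun h => absurd h hi⟩
  choose y hy hyFG hy0 using hpt
  have hσx : ∀ i, dist (σ (t i)) x ≤ t i := fun i => by
    have := hσ (t i) ⟨(ht0 i).le, htL i⟩ 0 ⟨le_rfl, hL.le⟩
    rwa [hσ0, sub_zero, abs_of_pos (ht0 i)] at this
  -- As `σ (t i)` is within `t i` of `x`, the ball of radius `ε t i` about it lies in `B(x, 2 t i)`;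
  -- the ratio of radii is `2 / ε`.
  have hyG : ∀ i, G (y i) ≤ K := fun i => by
    refine (hyFG i).2.trans (powerMean_le_maximalFn hq G (mul_pos hε (ht0 i)) (by positivity)
      (Metric.ball_subset_ball' ?_))
    have h1 := hσx i
    have h2 := ht0 i
    have h3 : 2 / ε * (ε * t i) = 2 * t i := by field_simp
    rw [h3]
    nlinarith
  have hyB : ∀ i, Metric.ball (y i) (31 * ε * t i) ⊆ (Ω : Set (Eucl n)) := fun i => by
    refine (Metric.ball_subset_ball' ?_).trans (hσΩ (t i) ⟨ht0 i, htL i⟩)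
    have := Metric.mem_ball.1 (hy i)
    linarith
  have hyΩ : ∀ i, y i ∈ (Ω : Set (Eucl n)) \ F := fun i =>
    ⟨hyB i (Metric.mem_ball_self (by have := ht0 i; positivity)), (hyFG i).1⟩
  have hyd : ∀ i, dist (y i) (y (i + 1)) ≤ 3 * ε * t i := fun i => by
    have h1 := Metric.mem_ball.1 (hy i)
    have h2 := Metric.mem_ball'.1 (hy (i + 1))
    have h3 := dist_triangle4 (y i) (σ (t i)) (σ (t (i + 1))) (y (i + 1))
    have h4 := hσ (t i) ⟨(ht0 i).le, htL i⟩ (t (i + 1)) ⟨(ht0 _).le, htL _⟩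
    have h5 : t i - t (i + 1) = ε * t i := by rw [hts, hl]; ring
    have h6 := ht0 i
    rw [h5, abs_of_pos (by positivity)] at h4
    have h7 : ε * t (i + 1) ≤ ε * t i := by
      rw [hts]
      exact mul_le_mul_of_nonneg_left (mul_le_of_le_one_left h6.le hl1.le) hε.le
    linarith
  have hstep : ∀ i, edist (u (y i)) (u (y (i + 1))) ≤
      ENNReal.ofReal (6 * L * ε) * K * ENNReal.ofReal l ^ i := by
    intro i
    have h6 := ht0 i
    have hle : t (i + 1) ≤ t i := by
      rw [hts]; exact mul_le_of_le_one_left h6.le hl1.le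
    -- Both points have room `31 ε t (i+1)`, a quarter of which exceeds their distance `3 ε t i`
    -- because `l ≥ 31/32`. So the local hypothesis applies.
    have hq4 := edist_le_min_bdryDist_div_four (R := 31 * ε * t (i + 1))
      ((Metric.ball_subset_ball (by gcongr)).trans (hyB i)) (hyB (i + 1))
      ((hyd i).trans (by
        rw [hts]
        have : 0 < ε * t i := by positivity
        have h7 : 31 / 32 ≤ l := by linarith
        nlinarith))
    calc edist (u (y i)) (u (y (i + 1)))
        ≤ edist (y i) (y (i + 1)) * (G (y i) + G (y (i + 1))) :=
          h _ (hyΩ i) _ (hyΩ (i + 1)) hq4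
      _ ≤ ENNReal.ofReal (3 * ε * t i) * (K + K) := by
          gcongr
          · rw [edist_dist]; exact ENNReal.ofReal_le_ofReal (hyd i)
          · exact hyG i
          · exact hyG (i + 1)
      _ = ENNReal.ofReal (3 * ε * t i * 2) * K := by
          rw [ENNReal.ofReal_mul (q := 2) (by positivity), ENNReal.ofReal_ofNat]; ring
      _ = _ := by
          rw [← ENNReal.ofReal_pow hl0.le, mul_right_comm (ENNReal.ofReal (6 * L * ε)), ← ENNReal.ofReal_mul (by positivity)]
          simp only [ht]
          congr 2
          ring
  have htlim : Filter.Tendsto t Filter.atTop (nhds 0) := by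
    have := (tendsto_pow_atTop_nhds_zero_of_lt_one hl0.le hl1).const_mul L
    rwa [mul_zero] at this
  have hyx : ∀ i, dist (y i) x ≤ 2 * t i := fun i => by
    have h1 := Metric.mem_ball.1 (hy i)
    have h2 := hσx i
    have h3 := dist_triangle (y i) (σ (t i)) x
    have h4 := ht0 i
    nlinarith
  have hlim : Filter.Tendsto (fun i => u (y i)) Filter.atTop (nhds (u x)) := by
    rw [tendsto_iff_edist_tendsto_0]
    have hb : Filter.Tendsto (fun i => ENNReal.ofReal (2 * t i) * (K + G x)) Filter.atTop
        (nhds 0) := by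
      have h1 := ENNReal.tendsto_ofReal (htlim.const_mul 2)
      rw [mul_zero, ENNReal.ofReal_zero] at h1
      have := ENNReal.Tendsto.mul_const (b := K + G x) h1
        (.inr (ENNReal.add_ne_top.2 ⟨hKt, hGfin x⟩))
      rwa [zero_mul] at this
    obtain ⟨R, hR, hRΩ⟩ := Metric.isOpen_iff.1 Ω.isOpen x hx.1
    refine tendsto_of_tendsto_of_tendsto_of_le_of_le' tendsto_const_nhds hb
      (Filter.Eventually.of_forall fun _ => zero_le) ?_
    filter_upwards [htlim.eventually (gt_mem_nhds (show (0 : ℝ) < R / 16 by positivity))]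
      with i hi
    have hd := hyx i
    have hq4 := edist_le_min_bdryDist_div_four (R := R / 2) (x := y i) (y := x)
      ((Metric.ball_subset_ball' (by linarith)).trans hRΩ)
      ((Metric.ball_subset_ball (by linarith)).trans hRΩ) (by linarith)
    calc edist (u (y i)) (u x) ≤ edist (y i) x * (G (y i) + G x) := h _ (hyΩ i) _ hx hq4
      _ ≤ ENNReal.ofReal (2 * t i) * (K + G x) := by
          gcongr
          · rw [edist_dist]; exact ENNReal.ofReal_le_ofReal hd
          · exact hyG i
  have := edist_le_tsum_of_edist_le_of_tendsto₀ _ hstep hlim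
  rw [hy0 0 rfl, edist_comm] at this
  refine this.trans (le_of_eq ?_)
  -- The geometric series has sum `1 / ε`, which cancels the `ε` in the step length: the total is
  -- independent of the fineness of the chain.
  have h1 : 1 - ENNReal.ofReal l = ENNReal.ofReal ε := by
    rw [← ENNReal.ofReal_one, ← ENNReal.ofReal_sub _ hl0.le, hl, sub_sub_cancel]
  rw [ENNReal.tsum_mul_left, ENNReal.tsum_geometric, h1, ENNReal.ofReal_mul (by positivity),
    mul_right_comm, mul_assoc (ENNReal.ofReal (6 * L)), ENNReal.mul_inv_cancel
    (by simpa using hε) (by simp), mul_one]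

/-- Cut the curve at its midpoint. On either half `min t (T - t)` is the arclength to the nearer
endpoint, so the cigar condition supplies the balls for both chains, which meet at one good point
near the midpoint. -/
theorem exists_edist_le_maximalFn_of_isUniformDomain {Ω : Opens (Eucl n)}
    (hΩ : IsUniformDomain Ω) {q : ℝ} (hq : 0 < q) :
    ∃ K : ℝ≥0∞, K ≠ ∞ ∧ ∀ (u : Eucl n → ℝ) (G : Eucl n → ℝ≥0∞), Measurable G →
      (∀ x, G x ≠ ∞) → ∀ F : Set (Eucl n), volume F = 0 →
      (∀ x ∈ (Ω : Set (Eucl n)) \ F, ∀ y ∈ (Ω : Set (Eucl n)) \ F,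
        edist x y ≤ min (bdryDist Ω x) (bdryDist Ω y) / 4 →
          edist (u x) (u y) ≤ edist x y * (G x + G y)) →
      ∀ x ∈ (Ω : Set (Eucl n)) \ F, ∀ y ∈ (Ω : Set (Eucl n)) \ F,
        edist (u x) (u y) ≤ edist x y * (K * maximalFn (fun z => G z ^ q) x ^ (1 / q) +
          K * maximalFn (fun z => G z ^ q) y ^ (1 / q)) := by
  obtain ⟨-, c, hc, hγ⟩ := hΩ
  -- Replacing `c` by `d ≥ 1` gives `32 ε = 1/d ≤ 1`, while the balls of radius `s / d` still fit
  -- into those of the cigar condition.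
  set d := max c 1 with hd
  have hd0 : 0 < d := hc.trans_le (le_max_left _ _)
  set ε : ℝ := 1 / (32 * d) with hε
  have hε0 : 0 < ε := by positivity
  have hε32 : 32 * ε = d⁻¹ := by rw [hε]; field_simp
  refine ⟨ENNReal.ofReal (3 * d) * ENNReal.ofReal ((2 / ε) ^ n) ^ (1 / q), ?_, ?_⟩
  · exact ENNReal.mul_ne_top ENNReal.ofReal_ne_top (ENNReal.rpow_ne_top_of_nonneg (by positivity) (by simp))
  intro u G hG hGfin F hF h x hx y hy
  rcases eq_or_ne x y with rfl | hxy
  · simp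
  obtain ⟨T, γ, hT, -, hspeed, h0, h1, hTc, hball⟩ := hγ x hx.1 y hy.1
  have hLip : ∀ s ∈ Set.Icc 0 T, ∀ t ∈ Set.Icc 0 T, dist (γ s) (γ t) ≤ |s - t| := by
    have aux : ∀ s ∈ Set.Icc 0 T, ∀ t ∈ Set.Icc 0 T, s ≤ t → dist (γ s) (γ t) ≤ t - s := by
      intro s hs t ht hst
      have h2 := eVariationOn.edist_le γ (s := Set.Icc 0 T ∩ Set.Icc s t)
        ⟨hs, Set.left_mem_Icc.2 hst⟩ ⟨ht, Set.right_mem_Icc.2 hst⟩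
      rw [hspeed hs ht, edist_dist, ENNReal.ofReal_le_ofReal_iff] at h2
      · simpa using h2
      · simpa using hst
    intro s hs t ht
    rcases le_total s t with hst | hst
    · rw [abs_of_nonpos (by linarith), neg_sub]; exact aux s hs t ht hst
    · rw [abs_of_nonneg (by linarith), dist_comm]; exact aux t ht s hs hst
  have hT0 : 0 < T := by
    have h2 := hLip 0 ⟨le_rfl, hT⟩ T ⟨hT, le_rfl⟩
    rw [h0, h1, zero_sub, abs_neg, abs_of_nonneg hT] at h2
    exact (dist_pos.2 hxy).trans_le h2
  set L := T / 2 with hL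
  have hL0 : 0 < L := by positivity
  have hcd : d⁻¹ ≤ c⁻¹ := inv_anti₀ hc (le_max_left _ _)
  have hε1 : 32 * ε ≤ 1 := by
    rw [hε32]; exact inv_le_one_of_one_le₀ (le_max_right _ _)
  have hball' : ∀ t ∈ Set.Ioo 0 T, ∀ s, 0 ≤ s → s ≤ min t (T - t) →
      Metric.ball (γ t) (32 * ε * s) ⊆ (Ω : Set (Eucl n)) := by
    intro t ht s hs0 hs
    refine (Metric.ball_subset_ball ?_).trans (hball t ht)
    rw [hε32]
    gcongr
  obtain ⟨z, hz, hzF, hzG⟩ :=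
    exists_mem_ball_le_powerMean hq hG hF (γ L) (mul_pos hε0 hL0)
  have hX := edist_le_maximalFn_of_cigar hq hG hGfin hF h hε0 hε1 hx hL0 h0
    (fun s hs t ht => hLip s ⟨hs.1, hs.2.trans (by linarith)⟩ t ⟨ht.1, ht.2.trans (by linarith)⟩)
    (fun t ht => hball' t ⟨ht.1, by linarith [ht.2]⟩ t ht.1.le
      (le_min le_rfl (by linarith [ht.2]))) hz hzF hzG
  have hTL : T - L = L := by rw [hL]; ring
  have hY := edist_le_maximalFn_of_cigar (σ := fun t => γ (T - t)) hq hG hGfin hF h hε0 hε1 hy hL0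
    (by simpa using h1)
    (fun s hs t ht => by
      have := hLip (T - s) ⟨by linarith [hs.2], by linarith [hs.1]⟩
        (T - t) ⟨by linarith [ht.2], by linarith [ht.1]⟩
      rwa [show T - s - (T - t) = -(s - t) by ring, abs_neg] at this)
    (fun t ht => hball' (T - t) ⟨by linarith [ht.2], by linarith [ht.1]⟩ t ht.1.le
      (le_min (by linarith [ht.2]) (by linarith))) (z := z)
    (by simpa only [hTL] using hz) hzF (by simpa only [hTL] using hzG)
  -- Here `6 L = 3 T ≤ 3 c |x - y|`.
  have hTd : ENNReal.ofReal (6 * L) ≤ edist x y * ENNReal.ofReal (3 * d) := by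
    rw [edist_dist, ← ENNReal.ofReal_mul dist_nonneg]
    refine ENNReal.ofReal_le_ofReal ?_
    have : c * dist x y ≤ d * dist x y := by
      gcongr
      exact le_max_left _ _
    linarith
  set K := ENNReal.ofReal ((2 / ε) ^ n) ^ (1 / q)
  set Nx := maximalFn (fun z => G z ^ q) x ^ (1 / q)
  set Ny := maximalFn (fun z => G z ^ q) y ^ (1 / q)
  calc edist (u x) (u y) ≤ edist (u x) (u z) + edist (u y) (u z) := edist_triangle_right _ _ _
    _ ≤ ENNReal.ofReal (6 * L) * (K * Nx) + ENNReal.ofReal (6 * L) * (K * Ny) := add_le_add hX hY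
    _ ≤ edist x y * ENNReal.ofReal (3 * d) * (K * Nx) +
        edist x y * ENNReal.ofReal (3 * d) * (K * Ny) := by gcongr
    _ = _ := by ring

/-! ### From small-scale to global pointwise gradients -/

theorem lpNorm_eq_lintegral {ε : Type*} [ENorm ε] (Ω : Opens (Eucl n)) {p : ℝ} (hp : 0 < p)
    (u : Eucl n → ε) :
    lpNorm Ω p u = (∫⁻ x in (Ω : Set (Eucl n)), ‖u x‖ₑ ^ p) ^ (1 / p) := by
  rw [lpNorm, eLpNorm_eq_lintegral_rpow_enorm_toReal (by simpa using hp) (by simp),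
    ENNReal.toReal_ofReal hp.le]

/-- Replaces `g` by the absolute value of a measurable representative, extended by zero, so that
maximal functions on the whole space apply. The predicate `P` selects the pairs for which the
inequality is required, covering both kinds of gradient. -/
theorem exists_measurable_enorm_gradient {Ω : Opens (Eucl n)} {p : ℝ} (hp : 0 < p)
    {u g : Eucl n → ℝ} (hg : MemLpOn Ω p g) {P : Eucl n → Eucl n → Prop} {F : Set (Eucl n)}
    (hF : volume F = 0)
    (h : ∀ x ∈ (Ω : Set (Eucl n)) \ F, ∀ y ∈ (Ω : Set (Eucl n)) \ F, P x y →
      |u x - u y| ≤ dist x y * (g x + g y)) :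
    ∃ (G : Eucl n → ℝ≥0∞) (F' : Set (Eucl n)), Measurable G ∧ (∀ x, G x ≠ ∞) ∧ volume F' = 0 ∧
      (∫⁻ x, G x ^ p) ^ (1 / p) = lpNorm Ω p g ∧
      ∀ x ∈ (Ω : Set (Eucl n)) \ F', ∀ y ∈ (Ω : Set (Eucl n)) \ F', P x y →
        edist (u x) (u y) ≤ edist x y * (G x + G y) := by
  set g' := hg.1.mk g with hg'
  have hae : ∀ᵐ x, x ∈ (Ω : Set (Eucl n)) → g x = g' x :=
    (ae_restrict_iff' Ω.isOpen.measurableSet).1 hg.1.ae_eq_mk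
  have hm : Measurable g' := hg.1.stronglyMeasurable_mk.measurable
  refine ⟨(Ω : Set (Eucl n)).indicator fun x => ‖g' x‖ₑ,
    F ∪ {x | ¬ (x ∈ (Ω : Set (Eucl n)) → g x = g' x)},
    hm.enorm.indicator Ω.isOpen.measurableSet, fun x => ?_, ?_, ?_, ?_⟩
  · by_cases hx : x ∈ (Ω : Set (Eucl n))
    · rw [Set.indicator_of_mem hx]; exact enorm_ne_top
    · rw [Set.indicator_of_notMem hx]; simp
  · exact measure_union_null hF (ae_iff.1 hae)
  · rw [lpNorm_eq_lintegral Ω hp, ← lintegral_indicator Ω.isOpen.measurableSet]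
    congr 1
    refine lintegral_congr_ae ?_
    filter_upwards [hae] with x hx
    by_cases hxΩ : x ∈ (Ω : Set (Eucl n))
    · rw [Set.indicator_of_mem hxΩ, Set.indicator_of_mem hxΩ, hx hxΩ]
    · rw [Set.indicator_of_notMem hxΩ, Set.indicator_of_notMem hxΩ, ENNReal.zero_rpow_of_pos hp]
  · rintro x ⟨hxΩ, hx⟩ y ⟨hyΩ, hy⟩ hP
    simp only [Set.mem_union, Set.mem_ofPred_eq, not_or, not_not] at hx hy
    have hxy := h x ⟨hxΩ, hx.1⟩ y ⟨hyΩ, hy.1⟩ hP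
    rw [hx.2 hxΩ, hy.2 hyΩ] at hxy
    rw [Set.indicator_of_mem hxΩ, Set.indicator_of_mem hyΩ, edist_dist (u x), edist_dist x,
      Real.dist_eq, Real.enorm_eq_ofReal_abs, Real.enorm_eq_ofReal_abs,
      ← ENNReal.ofReal_add (abs_nonneg _) (abs_nonneg _), ← ENNReal.ofReal_mul dist_nonneg]
    refine ENNReal.ofReal_le_ofReal (hxy.trans ?_)
    gcongr <;> exact le_abs_self _

/-- The converse passage. Since `toReal` sends `∞` to `0`, the null set where `G` is infinite must
join the exceptional set. -/
theorem exists_real_gradient {Ω : Opens (Eucl n)} {p : ℝ} (hp : 0 < p)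
    {u : Eucl n → ℝ} {G : Eucl n → ℝ≥0∞}
    (hG : AEMeasurable G (volume.restrict (Ω : Set (Eucl n))))
    (hfin : ∫⁻ x in (Ω : Set (Eucl n)), G x ^ p ≠ ∞)
    {P : Eucl n → Eucl n → Prop} {F : Set (Eucl n)} (hF : volume F = 0)
    (h : ∀ x ∈ (Ω : Set (Eucl n)) \ F, ∀ y ∈ (Ω : Set (Eucl n)) \ F, G x ≠ ∞ → G y ≠ ∞ → P x y →
      edist (u x) (u y) ≤ edist x y * (G x + G y)) :
    ∃ (g : Eucl n → ℝ) (F' : Set (Eucl n)), MemLpOn Ω p g ∧ volume F' = 0 ∧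
      lpNorm Ω p g = (∫⁻ x in (Ω : Set (Eucl n)), G x ^ p) ^ (1 / p) ∧
      ∀ x ∈ (Ω : Set (Eucl n)) \ F', ∀ y ∈ (Ω : Set (Eucl n)) \ F', P x y →
        |u x - u y| ≤ dist x y * (g x + g y) := by
  have hae : ∀ᵐ x ∂volume.restrict (Ω : Set (Eucl n)), G x ≠ ∞ := by
    filter_upwards [ae_lt_top' (hG.pow_const p) hfin] with x hx hGx
    rw [hGx, ENNReal.top_rpow_of_pos hp] at hx
    exact lt_irrefl _ hx
  have hnorm : lpNorm Ω p (fun x => (G x).toReal) =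
      (∫⁻ x in (Ω : Set (Eucl n)), G x ^ p) ^ (1 / p) := by
    rw [lpNorm_eq_lintegral Ω hp]
    congr 1
    refine lintegral_congr_ae ?_
    filter_upwards [hae] with x hx
    rw [Real.enorm_of_nonneg ENNReal.toReal_nonneg, ENNReal.ofReal_toReal hx]
  refine ⟨fun x => (G x).toReal, F ∪ {x | ¬ (x ∈ (Ω : Set (Eucl n)) → G x ≠ ∞)},
    ⟨hG.ennreal_toReal.aestronglyMeasurable, ?_⟩, ?_, hnorm, ?_⟩
  · change lpNorm Ω p (fun x => (G x).toReal) < ∞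
    rw [hnorm]
    exact ENNReal.rpow_lt_top_of_nonneg (by positivity) hfin
  · exact measure_union_null hF (ae_iff.1 ((ae_restrict_iff' Ω.isOpen.measurableSet).1 hae))
  · rintro x ⟨hxΩ, hx⟩ y ⟨hyΩ, hy⟩ hP
    simp only [Set.mem_union, Set.mem_ofPred_eq, not_or, not_not] at hx hy
    have hGx := hx.2 hxΩ
    have hGy := hy.2 hyΩ
    have hxy := h x ⟨hxΩ, hx.1⟩ y ⟨hyΩ, hy.1⟩ hGx hGy hP
    rw [← ENNReal.ofReal_toReal hGx, ← ENNReal.ofReal_toReal hGy, edist_dist, edist_dist,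
      ← ENNReal.ofReal_add ENNReal.toReal_nonneg ENNReal.toReal_nonneg,
      ← ENNReal.ofReal_mul dist_nonneg, ENNReal.ofReal_le_ofReal_iff
      (by have := @ENNReal.toReal_nonneg; positivity), Real.dist_eq] at hxy
    exact hxy

/-- The maximal theorem with exponent `p / q > 1`, applied to `G^q`. This is why a `q` strictly
below `p` is needed: the maximal function need not be bounded on `L^1`. -/
theorem exists_lintegral_maximalFn_rpow_le (hn : 1 ≤ n) {p q : ℝ} (hq : 0 < q) (hqp : q < p) :
    ∃ C : ℝ≥0∞, C ≠ ∞ ∧ ∀ G : Eucl n → ℝ≥0∞, Measurable G →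
      (∫⁻ x, (maximalFn (fun z => G z ^ q) x ^ (1 / q)) ^ p) ^ (1 / p) ≤
        C * (∫⁻ x, G x ^ p) ^ (1 / p) := by
  obtain ⟨C, hC, h⟩ := lintegral_maximalFn_rpow_le hn (s := p / q) ((one_lt_div hq).2 hqp)
  have hp : 0 < p := hq.trans hqp
  refine ⟨C ^ (1 / p), ENNReal.rpow_ne_top_of_nonneg (by positivity) hC, fun G hG => ?_⟩
  rw [← ENNReal.mul_rpow_of_nonneg _ _ (by positivity)]
  refine ENNReal.rpow_le_rpow ?_ (by positivity)
  have := h (fun z => G z ^ q) (hG.pow_const q)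
  simp_rw [← ENNReal.rpow_mul] at this ⊢
  rwa [mul_div_cancel₀ _ hq.ne', ← one_div_mul_eq_div] at this

theorem exists_exponent_between {p : ℝ} (hp : (n : ℝ) / (n + 1) < p) :
    ∃ q, (n : ℝ) / (n + 1) < q ∧ 0 < q ∧ q < p := by
  obtain ⟨q, h1, h2⟩ := exists_between hp
  exact ⟨q, h1, lt_of_le_of_lt (by positivity) h1, h2⟩

/-- A pointwise gradient at small scales yields a pointwise gradient on a uniform domain. -/
theorem exists_isGrad_of_isBallGrad (hn : 1 ≤ n) {p : ℝ} (hp : (n : ℝ) / (n + 1) < p)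
    {Ω : Opens (Eucl n)} (hΩ : IsUniformDomain Ω) :
    ∃ C : ℝ≥0∞, C ≠ ∞ ∧ ∀ u g : Eucl n → ℝ, MemLpOn Ω p g → IsBallGrad Ω u g →
      ∃ g', MemLpOn Ω p g' ∧ IsGrad Ω u g' ∧ lpNorm Ω p g' ≤ C * lpNorm Ω p g := by
  obtain ⟨q, hnq, hq, hqp⟩ := exists_exponent_between hp
  have hp0 : 0 < p := hq.trans hqp
  obtain ⟨C, hC, hmax⟩ := exists_lintegral_maximalFn_rpow_le hn hq hqp
  obtain ⟨K, hK, hchain⟩ := exists_edist_le_maximalFn_of_isUniformDomain hΩ hq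
  refine ⟨K * C, ENNReal.mul_ne_top hK hC, fun u g hg hug => ?_⟩
  obtain ⟨F, hF, h⟩ := hug
  obtain ⟨G, F', hG, hGfin, hF', hGp, hGu⟩ := exists_measurable_enorm_gradient hp0 hg hF h
  set H : Eucl n → ℝ≥0∞ := fun x => K * maximalFn (fun z => G z ^ q) x ^ (1 / q) with hH
  have hHm : Measurable H := ((measurable_maximalFn _).pow_const _).const_mul K
  have hHp : (∫⁻ x in (Ω : Set (Eucl n)), H x ^ p) ^ (1 / p) ≤ K * C * lpNorm Ω p g := by
    calc (∫⁻ x in (Ω : Set (Eucl n)), H x ^ p) ^ (1 / p)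
        ≤ (∫⁻ x, H x ^ p) ^ (1 / p) := by
          gcongr
          exact Measure.restrict_le_self
      _ = K * (∫⁻ x, (maximalFn (fun z => G z ^ q) x ^ (1 / q)) ^ p) ^ (1 / p) := by
          simp only [hH, ENNReal.mul_rpow_of_nonneg _ _ hp0.le]
          rw [lintegral_const_mul' _ _ (ENNReal.rpow_ne_top_of_nonneg hp0.le hK),
            ENNReal.mul_rpow_of_nonneg _ _ (by positivity), ← ENNReal.rpow_mul,
            mul_one_div_cancel hp0.ne', ENNReal.rpow_one]
      _ ≤ K * (C * (∫⁻ x, G x ^ p) ^ (1 / p)) := by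
          exact mul_le_mul_right (hmax G hG) K
      _ = _ := by rw [hGp, mul_assoc]
  have hHfin : ∫⁻ x in (Ω : Set (Eucl n)), H x ^ p ≠ ∞ := by
    intro htop
    rw [htop, ENNReal.top_rpow_of_pos (by positivity), top_le_iff] at hHp
    exact ENNReal.mul_ne_top (ENNReal.mul_ne_top hK hC) hg.2.ne hHp
  obtain ⟨g', F'', hg', hF'', hnorm, hgrad⟩ := exists_real_gradient hp0 (u := u)
    (P := fun _ _ => True) hHm.aemeasurable hHfin hF'
    fun x hx y hy _ _ _ => hchain u G hG hGfin F' hF' hGu x hx y hy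
  exact ⟨g', hg', ⟨F'', hF'', fun x hx y hy => hgrad x hx y hy trivial⟩, hnorm.trans_le hHp⟩

/-! ### From pointwise gradients to Hardy norms -/

theorem integrable_continuous_mul {Ω : Opens (Eucl n)} {u f : Eucl n → ℝ}
    (hu : LocallyIntegrableOn u (Ω : Set (Eucl n)) volume) (hf : Continuous f)
    (hc : HasCompactSupport f) (hs : tsupport f ⊆ (Ω : Set (Eucl n))) :
    Integrable fun x => f x * u x := by
  have h1 : IntegrableOn u (tsupport f) volume := hu.integrableOn_compact_subset hs hc
  have h2 := h1.continuousOn_mul hf.continuousOn hc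
  refine (integrableOn_iff_integrable_of_support_subset ?_).1 h2
  exact (Function.support_mul_subset_left f u).trans (subset_tsupport f)

theorem integral_fderiv_apply_eq_zero {f : Eucl n → ℝ} (hf : ContDiff ℝ 1 f)
    (hc : HasCompactSupport f) (v : Eucl n) : ∫ x, fderiv ℝ f x v = 0 := by
  have hf' : Continuous fun x => fderiv ℝ f x v :=
    (hf.continuous_fderiv one_ne_zero).clm_apply continuous_const
  have hcf' : HasCompactSupport fun x => fderiv ℝ f x v := hc.fderiv_apply ℝ v
  have := integral_bilinear_hasLineDerivAt_right_eq_neg_left_of_integrable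
    (μ := (volume : Measure (Eucl n))) (f := fun _ : Eucl n => (1 : ℝ)) (f' := fun _ => 0)
    (g := f) (g' := fun x => fderiv ℝ f x v) (v := v) (B := ContinuousLinearMap.mul ℝ ℝ)
    (by simp) (by simpa using hf'.integrable_of_hasCompactSupport hcf')
    (by simpa using hf.continuous.integrable_of_hasCompactSupport hc)
    (fun x _ => by simpa using (hasFDerivAt_const (1 : ℝ) x).hasLineDerivAt v)
    (fun x _ => (hf.differentiable one_ne_zero x).hasFDerivAt.hasLineDerivAt v)
  simpa using this

/-- The derivative of a test function has integral zero, so a constant may be subtracted from `u`;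
the factor `r^{-n-1}` is the normalization for `|α| = 1`, whence `N ≥ 1`. -/
theorem enorm_partialDeriv_le {Ω : Opens (Eucl n)} {u : Eucl n → ℝ}
    (hu : LocallyIntegrableOn u (Ω : Set (Eucl n)) volume) {N : ℕ} (hN : 1 ≤ N) (j : Fin n)
    {x : Eucl n} {r : ℝ} {φ : 𝓓(Ω, ℝ)} (hφ : IsNormalizedTest Ω N x r φ) (c : ℝ) :
    ‖partialDeriv Ω j u φ‖ₑ ≤
      ENNReal.ofReal (r ^ (n + 1))⁻¹ * ∫⁻ z in Metric.ball x r, edist (u z) c := by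
  set v : Eucl n := EuclideanSpace.single j (1 : ℝ)
  have hφ1 : ContDiff ℝ 1 φ := φ.contDiff.of_le (by exact_mod_cast le_top)
  have hf' : Continuous fun x => fderiv ℝ φ x v :=
    (hφ1.continuous_fderiv one_ne_zero).clm_apply continuous_const
  have hcf' : HasCompactSupport fun x => fderiv ℝ φ x v := φ.hasCompactSupport.fderiv_apply ℝ v
  have hsf : tsupport (fun x => fderiv ℝ φ x v) ⊆ tsupport φ := tsupport_fderiv_apply_subset ℝ v
  have hint1 := integrable_continuous_mul hu hf' hcf' (hsf.trans φ.tsupport_subset)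
  have hint2 : Integrable fun x => fderiv ℝ φ x v * c :=
    (hf'.integrable_of_hasCompactSupport hcf').mul_const c
  have h1 : ∫ x, fderiv ℝ φ x v * u x = ∫ x, fderiv ℝ φ x v * (u x - c) := by
    simp_rw [mul_sub]
    rw [integral_sub hint1 hint2, integral_mul_const,
      integral_fderiv_apply_eq_zero hφ1 φ.hasCompactSupport v, zero_mul, sub_zero]
  rw [partialDeriv_apply Ω j u hu, enorm_neg, h1]
  refine (enorm_integral_le_lintegral_enorm _).trans ?_
  rw [← lintegral_const_mul' _ _ (by simp), ← lintegral_indicator measurableSet_ball]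
  refine lintegral_mono fun z => ?_
  by_cases hz : z ∈ Metric.ball x r
  · rw [Set.indicator_of_mem hz, enorm_mul]
    gcongr
    · rw [Real.enorm_eq_ofReal_abs]
      refine ENNReal.ofReal_le_ofReal ?_
      have := hφ.2 1 hN (fun _ => j) z
      rwa [iteratedFDeriv_one_apply] at this
    · rw [edist_eq_enorm_sub]
  · have : fderiv ℝ φ z = 0 := fderiv_of_notMem_tsupport ℝ fun h => hz (hφ.1 h)
    simp [this]

/-- The grand maximal functions of the derivatives are controlled by a pointwise gradient. -/
theorem exists_grandMaximal_le_maximalFn {q : ℝ} (hq : (n : ℝ) / (n + 1) < q) (hq1 : q ≤ 1) :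
    ∃ C : ℝ≥0∞, C ≠ ∞ ∧ ∀ (Ω : Opens (Eucl n)) (u : Eucl n → ℝ) (G : Eucl n → ℝ≥0∞),
      LocallyIntegrableOn u (Ω : Set (Eucl n)) volume → Measurable G →
      (∀ x, G x ≠ ∞) → ∀ F : Set (Eucl n), volume F = 0 →
      (∀ x ∈ (Ω : Set (Eucl n)) \ F, ∀ y ∈ (Ω : Set (Eucl n)) \ F,
          edist (u x) (u y) ≤ edist x y * (G x + G y)) →
      ∀ N : ℕ, 1 ≤ N → ∀ j : Fin n, ∀ x ∈ Ω,
        grandMaximal Ω N (bdryDist Ω x / 2) (partialDeriv Ω j u) x ≤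
          C * maximalFn (fun z => G z ^ q) x ^ (1 / q) := by
  have hq0 : 0 < q := lt_of_le_of_lt (by positivity) hq
  obtain ⟨C, hC, hpoinc⟩ := exists_poincare_const hq hq1
  set w := volume (Metric.ball (0 : Eucl n) 1)
  refine ⟨C * w * ENNReal.ofReal (2 ^ n) ^ (1 / q), ?_, ?_⟩
  · exact ENNReal.mul_ne_top (ENNReal.mul_ne_top hC (volume_ball_ne_top _ _))
      (ENNReal.rpow_ne_top_of_nonneg (by positivity) ENNReal.ofReal_ne_top)
  intro Ω u G hu hG hGfin F hF h N hN j x hx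
  refine iSup_le fun r => iSup_le fun hr => iSup_le fun hrR => iSup_le fun φ => iSup_le fun hφ => ?_
  -- The restriction `r ≤ d(x, ∂Ω)/2` on the scales is what puts the doubled ball of the Poincaré
  -- inequality inside `Ω`.
  have hball : Metric.ball x (2 * r) ⊆ (Ω : Set (Eucl n)) := by
    refine ball_subset_of_le_bdryDist hx ?_
    rw [ENNReal.le_div_iff_mul_le (by simp) (by simp)] at hrR
    rwa [mul_comm, ENNReal.ofReal_mul hr.le, ENNReal.ofReal_ofNat]
  obtain ⟨c, hc⟩ := hpoinc u G hG hGfin F hF x r hr fun y hy z hz =>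
    h y ⟨hball hy.1, hy.2⟩ z ⟨hball hz.1, hz.2⟩
  set V := volume (Metric.ball x r) with hV
  have hM : ((∫⁻ z in Metric.ball x (2 * r), G z ^ q) / V) ^ (1 / q) ≤
      ENNReal.ofReal (2 ^ n) ^ (1 / q) * maximalFn (fun z => G z ^ q) x ^ (1 / q) := by
    rw [← ENNReal.mul_rpow_of_nonneg _ _ (by positivity)]
    gcongr
    rw [ENNReal.div_le_iff (volume_ball_ne_zero x hr) (volume_ball_ne_top x r)]
    refine (setLIntegral_ball_le_maximalFn _ _ (by positivity)).trans (le_of_eq ?_)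
    rw [volume_ball_eq x hr, volume_ball_eq x (by positivity), mul_pow,
      ENNReal.ofReal_mul (by positivity)]
    ring
  have hrn : ENNReal.ofReal (r ^ (n + 1))⁻¹ * (ENNReal.ofReal r * V) = w := by
    rw [hV, volume_ball_eq x hr, ← mul_assoc, ← mul_assoc, ← ENNReal.ofReal_mul (by positivity),
      ← ENNReal.ofReal_mul (by positivity)]
    rw [show (r ^ (n + 1))⁻¹ * r * r ^ n = 1 by field_simp; ring, ENNReal.ofReal_one, one_mul]
  calc ‖partialDeriv Ω j u φ‖ₑ
      ≤ ENNReal.ofReal (r ^ (n + 1))⁻¹ * ∫⁻ z in Metric.ball x r, edist (u z) c :=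
        enorm_partialDeriv_le hu hN j hφ c
    _ ≤ ENNReal.ofReal (r ^ (n + 1))⁻¹ * (C * (ENNReal.ofReal r * (V *
        (ENNReal.ofReal (2 ^ n) ^ (1 / q) * maximalFn (fun z => G z ^ q) x ^ (1 / q))))) := by
        refine mul_le_mul_right (hc.trans ?_) _
        gcongr
    _ = C * (ENNReal.ofReal (r ^ (n + 1))⁻¹ * (ENNReal.ofReal r * V)) *
        ENNReal.ofReal (2 ^ n) ^ (1 / q) * maximalFn (fun z => G z ^ q) x ^ (1 / q) := by ring
    _ = _ := by rw [hrn]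

/-- For `p < 1`, membership in `L^p` alone does not give local integrability. The Poincaré
inequality with `q = p` does: it makes `u - c` integrable on small balls. -/
theorem locallyIntegrableOn_of_isGrad {p : ℝ} (hp : (n : ℝ) / (n + 1) < p) (hp1 : p ≤ 1)
    {Ω : Opens (Eucl n)} {u g : Eucl n → ℝ} (hu : MemLpOn Ω p u) (hg : MemLpOn Ω p g)
    (h : IsGrad Ω u g) : LocallyIntegrableOn u (Ω : Set (Eucl n)) volume := by
  have hp0 : 0 < p := lt_of_le_of_lt (by positivity) hp
  obtain ⟨F₀, hF₀, h⟩ := h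
  obtain ⟨G, F, hG, hGfin, hF, hGp, hGu⟩ :=
    exists_measurable_enorm_gradient hp0 hg (P := fun _ _ => True) hF₀
      fun x hx y hy _ => h x hx y hy
  obtain ⟨C, hC, hpoinc⟩ := exists_poincare_const hp hp1
  intro x hx
  obtain ⟨R, hR, hRΩ⟩ := Metric.isOpen_iff.1 Ω.isOpen x hx
  have h2 : 2 * (R / 2) = R := by ring
  obtain ⟨c, hc⟩ := hpoinc u G hG hGfin F hF x (R / 2) (half_pos hR) fun y hy z hz => by
    rw [h2] at hy hz
    exact hGu y ⟨hRΩ hy.1, hy.2⟩ z ⟨hRΩ hz.1, hz.2⟩ trivial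
  have hsub : Metric.ball x (R / 2) ⊆ (Ω : Set (Eucl n)) :=
    (Metric.ball_subset_ball (by linarith)).trans hRΩ
  refine ⟨Metric.ball x (R / 2), mem_nhdsWithin_of_mem_nhds
    (Metric.ball_mem_nhds x (half_pos hR)), ?_⟩
  have hm : AEStronglyMeasurable u (volume.restrict (Metric.ball x (R / 2))) :=
    hu.1.mono_measure (Measure.restrict_mono hsub le_rfl)
  have hI : ∫⁻ z, G z ^ p ≠ ∞ := fun htop => by
    rw [htop, ENNReal.top_rpow_of_pos (by positivity)] at hGp
    exact hg.2.ne hGp.symm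
  have hfin : IntegrableOn (fun y => u y - c) (Metric.ball x (R / 2)) volume := by
    refine ⟨hm.sub aestronglyMeasurable_const, ?_⟩
    rw [hasFiniteIntegral_iff_enorm]
    simp_rw [← edist_eq_enorm_sub]
    refine hc.trans_lt (lt_top_iff_ne_top.2 ?_)
    refine ENNReal.mul_ne_top hC (ENNReal.mul_ne_top ENNReal.ofReal_ne_top
      (ENNReal.mul_ne_top (volume_ball_ne_top _ _)
      (ENNReal.rpow_ne_top_of_nonneg (by positivity) (ENNReal.div_ne_top ?_
        (volume_ball_ne_zero _ (half_pos hR))))))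
    exact ne_top_of_le_ne_top hI (setLIntegral_le_lintegral _ _)
  have := hfin.add (integrableOn_const (C := c) (volume_ball_ne_top x (R / 2)))
  refine this.congr_fun (fun y _ => ?_) measurableSet_ball
  simp

theorem exists_hardyNorm_partialDeriv_le (hn : 1 ≤ n) {p : ℝ} (hp : (n : ℝ) / (n + 1) < p)
    (hp1 : p ≤ 1) :
    ∃ C : ℝ≥0∞, C ≠ ∞ ∧ ∀ (Ω : Opens (Eucl n)) (u g : Eucl n → ℝ), MemLpOn Ω p u →
      MemLpOn Ω p g → IsGrad Ω u g → ∀ N : ℕ, 1 ≤ N → ∀ j : Fin n,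
        hardyNorm Ω p N (partialDeriv Ω j u) ≤ C * lpNorm Ω p g := by
  obtain ⟨q, hnq, hq, hqp⟩ := exists_exponent_between hp
  have hp0 : 0 < p := hq.trans hqp
  obtain ⟨C, hC, hmax⟩ := exists_lintegral_maximalFn_rpow_le hn hq hqp
  obtain ⟨K, hK, hgrand⟩ := exists_grandMaximal_le_maximalFn hnq (hqp.le.trans hp1)
  refine ⟨K * C, ENNReal.mul_ne_top hK hC, fun Ω u g hu hg hug N hN j => ?_⟩
  have hloc := locallyIntegrableOn_of_isGrad hp hp1 hu hg hug
  obtain ⟨F₀, hF₀, h⟩ := hug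
  obtain ⟨G, F, hG, hGfin, hF, hGp, hGu⟩ :=
    exists_measurable_enorm_gradient hp0 hg (P := fun _ _ => True) hF₀
      fun x hx y hy _ => h x hx y hy
  rw [hardyNorm, lpNorm_eq_lintegral Ω hp0]
  calc (∫⁻ x in (Ω : Set (Eucl n)),
        ‖grandMaximal Ω N (bdryDist Ω x / 2) (partialDeriv Ω j u) x‖ₑ ^ p) ^ (1 / p)
      ≤ (∫⁻ x in (Ω : Set (Eucl n)),
        (K * maximalFn (fun z => G z ^ q) x ^ (1 / q)) ^ p) ^ (1 / p) := by
        refine ENNReal.rpow_le_rpow (setLIntegral_mono' Ω.isOpen.measurableSet fun x hx =>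
          ENNReal.rpow_le_rpow ?_ hp0.le) (by positivity)
        rw [enorm_eq_self]
        exact hgrand Ω u G hloc hG hGfin F hF (fun x hx y hy => hGu x hx y hy trivial) N hN j x hx
    _ ≤ (∫⁻ x, (K * maximalFn (fun z => G z ^ q) x ^ (1 / q)) ^ p) ^ (1 / p) := by
        gcongr
        exact Measure.restrict_le_self
    _ = K * (∫⁻ x, (maximalFn (fun z => G z ^ q) x ^ (1 / q)) ^ p) ^ (1 / p) := by
        simp only [ENNReal.mul_rpow_of_nonneg _ _ hp0.le]
        rw [lintegral_const_mul' _ _ (ENNReal.rpow_ne_top_of_nonneg hp0.le hK),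
          ENNReal.mul_rpow_of_nonneg _ _ (by positivity), ← ENNReal.rpow_mul,
          mul_one_div_cancel hp0.ne', ENNReal.rpow_one]
    _ ≤ K * (C * (∫⁻ x, G x ^ p) ^ (1 / p)) := mul_le_mul_right (hmax G hG) K
    _ = _ := by rw [hGp, mul_assoc]

/-! ### Mollifiers and their derivative in the scale -/

/-- The `L¹`-normalized dilation of `η` by the factor `τ`, centred at `x`. -/
noncomputable def dilate (η : Eucl n → ℝ) (τ : ℝ) (x z : Eucl n) : ℝ :=
  (τ ^ n)⁻¹ * η (τ⁻¹ • (z - x))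

theorem contDiff_dilate {η : Eucl n → ℝ} {k : ℕ∞} (hη : ContDiff ℝ k η) (τ : ℝ) (x : Eucl n) :
    ContDiff ℝ k (dilate η τ x) :=
  contDiff_const.mul (hη.comp ((contDiff_id.sub contDiff_const).const_smul _))

theorem tsupport_dilate_subset {η : Eucl n → ℝ} {s τ : ℝ}
    (hs : tsupport η ⊆ Metric.closedBall 0 s) (hτ : 0 < τ) (x : Eucl n) :
    tsupport (dilate η τ x) ⊆ Metric.closedBall x (s * τ) := by
  refine closure_minimal (fun z hz => ?_) Metric.isClosed_closedBall
  have h1 : η (τ⁻¹ • (z - x)) ≠ 0 := fun h => hz (by simp [dilate, h])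
  have h2 := hs (subset_tsupport _ h1)
  rw [mem_closedBall_zero_iff, norm_smul, Real.norm_of_nonneg (inv_nonneg.2 hτ.le),
    inv_mul_le_iff₀ hτ] at h2
  rw [mem_closedBall_iff_norm]
  linarith

theorem hasCompactSupport_dilate {η : Eucl n → ℝ} {s τ : ℝ}
    (hs : tsupport η ⊆ Metric.closedBall 0 s) (hτ : 0 < τ) (x : Eucl n) :
    HasCompactSupport (dilate η τ x) :=
  (isCompact_closedBall x (s * τ)).of_isClosed_subset (isClosed_tsupport _)
    (tsupport_dilate_subset hs hτ x)

/-- The dilation of a smooth function as a test function on `Ω`. -/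
noncomputable def testDilate (Ω : Opens (Eucl n)) {η : Eucl n → ℝ} (hη : ContDiff ℝ ((⊤ : ℕ∞)) η)
    {s τ : ℝ} (hs : tsupport η ⊆ Metric.closedBall 0 s) (hτ : 0 < τ) (x : Eucl n)
    (hΩ : Metric.closedBall x (s * τ) ⊆ (Ω : Set (Eucl n))) : 𝓓(Ω, ℝ) :=
  ⟨dilate η τ x, contDiff_dilate hη τ x, hasCompactSupport_dilate hs hτ x,
    (tsupport_dilate_subset hs hτ x).trans hΩ⟩

theorem norm_iteratedFDeriv_dilate_le {η : Eucl n → ℝ} {k : ℕ} (hη : ContDiff ℝ k η) {K : ℝ}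
    (hK : ∀ w, ‖iteratedFDeriv ℝ k η w‖ ≤ K) {τ : ℝ} (hτ : 0 < τ) (x z : Eucl n) :
    ‖iteratedFDeriv ℝ k (dilate η τ x) z‖ ≤ K * (τ ^ (n + k))⁻¹ := by
  have hc : ContDiff ℝ k fun z => η (τ⁻¹ • z) := hη.comp (contDiff_id.const_smul _)
  have hc' : ContDiff ℝ k fun z => η (τ⁻¹ • (z - x)) :=
    hη.comp ((contDiff_id.sub contDiff_const).const_smul _)
  have h1 : iteratedFDeriv ℝ k (dilate η τ x) z =
      (τ ^ n)⁻¹ • ((τ⁻¹) ^ k • iteratedFDeriv ℝ k η (τ⁻¹ • (z - x))) := by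
    change iteratedFDeriv ℝ k (fun z => (τ ^ n)⁻¹ • η (τ⁻¹ • (z - x))) z = _
    rw [iteratedFDeriv_const_smul_apply' hc'.contDiffAt,
      iteratedFDeriv_comp_sub (f := fun z => η (τ⁻¹ • z)), iteratedFDeriv_comp_const_smul _ hη]
  rw [h1, norm_smul, norm_smul, Real.norm_of_nonneg (by positivity),
    Real.norm_of_nonneg (by positivity), ← mul_assoc, mul_comm K, pow_add, mul_inv, inv_pow]
  gcongr
  exact hK _

theorem hasFDerivAt_dilate {η : Eucl n → ℝ} (hη : Differentiable ℝ η) (τ : ℝ) (x z : Eucl n) :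
    HasFDerivAt (dilate η τ x) (((τ ^ n)⁻¹ * τ⁻¹) • fderiv ℝ η (τ⁻¹ • (z - x))) z := by
  have h1 : HasFDerivAt (fun z : Eucl n => τ⁻¹ • (z - x))
      (τ⁻¹ • ContinuousLinearMap.id ℝ (Eucl n)) z :=
    ((hasFDerivAt_id z).sub_const x).const_smul τ⁻¹
  have h2 := ((hη (τ⁻¹ • (z - x))).hasFDerivAt.comp z h1).const_mul (τ ^ n)⁻¹
  convert! h2 using 1
  rw [ContinuousLinearMap.comp_smul, ContinuousLinearMap.comp_id, smul_smul]

/-- The function `w ↦ w_j η(w)`. -/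
noncomputable def coordMul (η : Eucl n → ℝ) (j : Fin n) (w : Eucl n) : ℝ := w j * η w

theorem contDiff_coordMul {η : Eucl n → ℝ} {k : ℕ∞} (hη : ContDiff ℝ k η) (j : Fin n) :
    ContDiff ℝ k (coordMul η j) :=
  (EuclideanSpace.proj j : Eucl n →L[ℝ] ℝ).contDiff.mul hη

theorem tsupport_coordMul_subset (η : Eucl n → ℝ) (j : Fin n) :
    tsupport (coordMul η j) ⊆ tsupport η :=
  closure_mono (Function.support_mul_subset_right (fun w : Eucl n => w j) η)

theorem fderiv_coordMul_apply {η : Eucl n → ℝ} (hη : Differentiable ℝ η) (j : Fin n)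
    (w : Eucl n) : fderiv ℝ (coordMul η j) w (EuclideanSpace.single j 1) =
      w j * fderiv ℝ η w (EuclideanSpace.single j 1) + η w := by
  have h1 : HasFDerivAt (fun w : Eucl n => w j)
      (EuclideanSpace.proj j : Eucl n →L[ℝ] ℝ) w :=
    (EuclideanSpace.proj j : Eucl n →L[ℝ] ℝ).hasFDerivAt
  have h2 : HasFDerivAt (coordMul η j) _ w := h1.mul (hη w).hasFDerivAt
  rw [h2.fderiv]
  simp

/-- The divergence of the field `w η(w)` is `w · ∇η + n η`. After dilation this is exactly minus the
derivative in `τ` found in `hasDerivAt_dilate`. -/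
theorem sum_fderiv_dilate_coordMul {η : Eucl n → ℝ} (hη : ContDiff ℝ 1 η) (τ : ℝ)
    (x z : Eucl n) :
    ∑ j, fderiv ℝ (dilate (coordMul η j) τ x) z (EuclideanSpace.single j 1) =
      (τ ^ n)⁻¹ * τ⁻¹ * (fderiv ℝ η (τ⁻¹ • (z - x)) (τ⁻¹ • (z - x)) +
        n * η (τ⁻¹ • (z - x))) := by
  have hd := hη.differentiable one_ne_zero
  have hdj : ∀ j, Differentiable ℝ (coordMul η j) := fun j =>
    (contDiff_coordMul (k := 1) hη j).differentiable one_ne_zero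
  set w := τ⁻¹ • (z - x)
  have hw : fderiv ℝ η w w = ∑ j, w j * fderiv ℝ η w (EuclideanSpace.single j 1) := by
    have h1 := (EuclideanSpace.basisFun (Fin n) ℝ).sum_repr w
    conv_lhs => enter [2]; rw [← h1]
    simp [map_sum]
  rw [hw]
  calc ∑ j, fderiv ℝ (dilate (coordMul η j) τ x) z (EuclideanSpace.single j 1)
      = ∑ j, (τ ^ n)⁻¹ * τ⁻¹ *
        (w j * fderiv ℝ η w (EuclideanSpace.single j 1) + η w) := by
        refine Finset.sum_congr rfl fun j _ => ?_
        rw [(hasFDerivAt_dilate (hdj j) τ x z).fderiv, ← fderiv_coordMul_apply hd]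
        rfl
    _ = _ := by rw [← Finset.mul_sum, Finset.sum_add_distrib]; simp

theorem hasDerivAt_dilate {η : Eucl n → ℝ} (hη : Differentiable ℝ η) {τ : ℝ} (hτ : τ ≠ 0)
    (x z : Eucl n) :
    HasDerivAt (fun τ => dilate η τ x z)
      (-((τ ^ n)⁻¹ * τ⁻¹ * (fderiv ℝ η (τ⁻¹ • (z - x)) (τ⁻¹ • (z - x)) +
        n * η (τ⁻¹ • (z - x))))) τ := by
  have h1 : HasDerivAt (fun τ : ℝ => τ⁻¹ • (z - x)) ((-(τ ^ 2)⁻¹) • (z - x)) τ :=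
    (hasDerivAt_inv hτ).smul_const (z - x)
  have h2 := (hη (τ⁻¹ • (z - x))).hasFDerivAt.comp_hasDerivAt τ h1
  have h3 : HasDerivAt (fun τ : ℝ => (τ ^ n)⁻¹) _ τ := (hasDerivAt_pow n τ).inv (pow_ne_zero n hτ)
  have h4 := h3.mul h2
  convert! h4 using 1
  have h5 : (-(τ ^ 2)⁻¹) • (z - x) = (-τ⁻¹) • (τ⁻¹ • (z - x)) := by
    rw [smul_smul]; congr 1; field_simp
  rw [h5, map_smul _ (-τ⁻¹), smul_eq_mul]
  -- The derivative of `τ ^ n` carries the truncated exponent `n - 1`, so dimension zero is treated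
  -- apart.
  rcases n with _ | m
  · simp
  · simp only [Nat.add_sub_cancel, Function.comp]
    field_simp
    ring

/-- Differentiate under the integral and recognize minus a divergence; moving it onto `u` leaves the
distributional derivatives tested on the dilations of `w_j η(w)`. -/
theorem hasDerivAt_integral_dilate_mul {Ω : Opens (Eucl n)} {u : Eucl n → ℝ}
    (hu : LocallyIntegrableOn u (Ω : Set (Eucl n)) volume) {η : Eucl n → ℝ}
    (hη : ContDiff ℝ ((⊤ : ℕ∞)) η) {s : ℝ} (hs1 : s ≤ 1)
    (hs : tsupport η ⊆ Metric.closedBall 0 s) {x : Eucl n} {R : ℝ}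
    (hR : Metric.closedBall x R ⊆ (Ω : Set (Eucl n))) {τ : ℝ} (hτ : 0 < τ) (hτR : τ < R)
    (ψ : Fin n → 𝓓(Ω, ℝ)) (hψ : ∀ j z, ψ j z = dilate (coordMul η j) τ x z) :
    HasDerivAt (fun τ => ∫ z, dilate η τ x z * u z) (∑ j, partialDeriv Ω j u (ψ j)) τ := by
  have hη1 : ContDiff ℝ 1 η := hη.of_le (by exact_mod_cast le_top)
  have hd := hη1.differentiable one_ne_zero
  have hcη : HasCompactSupport η :=
    (isCompact_closedBall 0 s).of_isClosed_subset (isClosed_tsupport _) hs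
  set k : Eucl n → ℝ := fun w => fderiv ℝ η w w + n * η w with hk
  have hkc : Continuous k :=
    ((hη1.continuous_fderiv one_ne_zero).clm_apply continuous_id).add
      (continuous_const.mul hη1.continuous)
  have hk0 : ∀ w, w ∉ tsupport η → k w = 0 := fun w hw => by
    simp [hk, fderiv_of_notMem_tsupport ℝ hw, image_eq_zero_of_notMem_tsupport hw]
  obtain ⟨B, hB⟩ : ∃ B, ∀ w, ‖k w‖ ≤ B := by
    refine hkc.bounded_above_of_compact_support (hcη.mono' ?_)
    intro w hw
    by_contra h
    exact hw (hk0 w h)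
  have hB0 : 0 ≤ B := (norm_nonneg _).trans (hB 0)
  have hsub : ∀ t, 0 < t → t < R → tsupport (dilate η t x) ⊆ (Ω : Set (Eucl n)) := by
    intro t ht htR
    refine ((tsupport_dilate_subset hs ht x).trans (Metric.closedBall_subset_closedBall ?_)).trans hR
    nlinarith
  have hint : ∀ t, 0 < t → t < R → Integrable fun z => dilate η t x z * u z := fun t ht htR =>
    integrable_continuous_mul hu (contDiff_dilate hη t x).continuous
      (hasCompactSupport_dilate hs ht x) (hsub t ht htR)
  -- Staying above `τ / 2` bounds the factor `t^{-n-1}`, and staying below `R` keeps the supports in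
  -- one compact ball; together they give the dominating function.
  have hIoo : Set.Ioo (τ / 2) R ∈ nhds τ := Ioo_mem_nhds (by linarith) hτR
  have huR : IntegrableOn u (Metric.closedBall x R) volume :=
    hu.integrableOn_compact_subset hR (isCompact_closedBall x R)
  set F' : ℝ → Eucl n → ℝ := fun t z => -((t ^ n)⁻¹ * t⁻¹ * k (t⁻¹ • (z - x))) * u z with hF'
  have hsumj : ∑ j, partialDeriv Ω j u (ψ j) = ∫ z, F' τ z := by
    have hψe : ∀ j, (ψ j : Eucl n → ℝ) = dilate (coordMul η j) τ x := fun j => funext (hψ j)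
    have hψ1 : ∀ j, ContDiff ℝ 1 (ψ j) := fun j =>
      (ψ j).contDiff.of_le (by exact_mod_cast le_top)
    simp_rw [partialDeriv_apply Ω _ u hu]
    rw [Finset.sum_neg_distrib, ← integral_finsetSum]
    · rw [← integral_neg]
      congr 1
      funext z
      rw [← Finset.sum_mul]
      simp_rw [hψe]
      rw [sum_fderiv_dilate_coordMul hη1, ← neg_mul]
    · intro j _
      exact integrable_continuous_mul hu
        (((hψ1 j).continuous_fderiv one_ne_zero).clm_apply continuous_const)
        ((ψ j).hasCompactSupport.fderiv_apply ℝ _)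
        ((tsupport_fderiv_apply_subset ℝ _).trans (ψ j).tsupport_subset)
  rw [hsumj]
  have hkt : ∀ t, 0 < t → t < R → ∀ z, z ∉ Metric.closedBall x R → k (t⁻¹ • (z - x)) = 0 := by
    intro t ht htR z hz
    refine hk0 _ fun h => hz ?_
    have h2 := hs h
    rw [mem_closedBall_zero_iff, norm_smul, Real.norm_of_nonneg (inv_nonneg.2 ht.le),
      inv_mul_le_iff₀ ht] at h2
    rw [mem_closedBall_iff_norm]
    nlinarith
  refine (hasDerivAt_integral_of_dominated_loc_of_deriv_le (F := fun t z => dilate η t x z * u z)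
    (F' := F') (bound := (Metric.closedBall x R).indicator
      fun z => ((τ / 2) ^ n)⁻¹ * (τ / 2)⁻¹ * B * ‖u z‖) hIoo ?_ (hint τ hτ hτR) ?_
    (Filter.Eventually.of_forall fun z t ht => ?_) ?_
    (Filter.Eventually.of_forall fun z t ht => ?_)).2
  · filter_upwards [hIoo] with t ht
    exact (hint t (by linarith [ht.1]) ht.2).aestronglyMeasurable
  · have h1 : Integrable (fun z => -((τ ^ n)⁻¹ * τ⁻¹ * k (τ⁻¹ • (z - x))) * u z) := by
      have hcont : Continuous fun z => -((τ ^ n)⁻¹ * τ⁻¹ * k (τ⁻¹ • (z - x))) := by fun_prop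
      have hsupp : Function.support (fun z => -((τ ^ n)⁻¹ * τ⁻¹ * k (τ⁻¹ • (z - x)))) ⊆
          Metric.closedBall x R := by
        intro z hz
        by_contra h
        exact hz (by simp [hkt τ hτ hτR z h])
      have hts := closure_minimal hsupp Metric.isClosed_closedBall
      exact integrable_continuous_mul hu hcont
        ((isCompact_closedBall x R).of_isClosed_subset (isClosed_tsupport _) hts) (hts.trans hR)
    exact h1.aestronglyMeasurable
  · have ht0 : 0 < t := by linarith [ht.1]
    by_cases hz : z ∈ Metric.closedBall x R
    · rw [Set.indicator_of_mem hz]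
      simp only [hF', norm_mul, norm_neg]
      rw [Real.norm_of_nonneg (by positivity), Real.norm_of_nonneg (by positivity)]
      have := ht.1.le
      gcongr
      exact hB _
    · rw [Set.indicator_of_notMem hz]
      simp [hF', hkt t ht0 ht.2 z hz]
  · exact (integrable_indicator_iff Metric.isClosed_closedBall.measurableSet).2
      (huR.norm.const_mul _)
  · have ht0 : 0 < t := by linarith [ht.1]
    exact (hasDerivAt_dilate hd ht0.ne' x z).mul_const (u z)

/-- Lebesgue differentiation is applied to the extensions by zero of `u` from countably many open
sets covering `Ω` on which it is integrable; near a point of such a set the extension agrees with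
`u`. -/
theorem ae_tendsto_average_norm_sub {Ω : Opens (Eucl n)} {u : Eucl n → ℝ}
    (hu : LocallyIntegrableOn u (Ω : Set (Eucl n)) volume) :
    ∀ᵐ x, x ∈ (Ω : Set (Eucl n)) → Filter.Tendsto
      (fun r => ⨍ y in Metric.closedBall x r, ‖u y - u x‖) (nhdsWithin 0 (Set.Ioi 0))
      (nhds 0) := by
  obtain ⟨U, hUo, hU, hUi⟩ := hu.exists_nat_integrableOn
  have hopen : ∀ i, IsOpen (U i ∩ (Ω : Set (Eucl n))) := fun i => (hUo i).inter Ω.isOpen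
  have hae : ∀ i, ∀ᵐ x, Filter.Tendsto (fun r => ⨍ y in Metric.closedBall x r,
      ‖(U i ∩ (Ω : Set (Eucl n))).indicator u y - (U i ∩ (Ω : Set (Eucl n))).indicator u x‖)
      (nhdsWithin 0 (Set.Ioi 0)) (nhds 0) := by
    intro i
    have hi := ((hUi i).integrable_indicator (hopen i).measurableSet).locallyIntegrable
    filter_upwards [IsUnifLocDoublingMeasure.ae_tendsto_average_norm_sub volume hi 1] with x hx
    refine hx (fun _ => x) (fun r => r) Filter.tendsto_id ?_
    filter_upwards [self_mem_nhdsWithin] with r hr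
    simpa using (Set.mem_Ioi.1 hr).le
  filter_upwards [ae_all_iff.2 hae] with x hx hxΩ
  obtain ⟨i, hi⟩ := Set.mem_iUnion.1 (hU hxΩ)
  have hmem : x ∈ U i ∩ (Ω : Set (Eucl n)) := ⟨hi, hxΩ⟩
  obtain ⟨ε, hε, hball⟩ := Metric.isOpen_iff.1 (hopen i) x hmem
  refine (hx i).congr' ?_
  filter_upwards [nhdsWithin_le_nhds (gt_mem_nhds hε)] with r hr
  rw [setAverage_eq, setAverage_eq]
  congr 1
  refine setIntegral_congr_fun Metric.isClosed_closedBall.measurableSet fun y hy => ?_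
  have hy' : y ∈ U i ∩ (Ω : Set (Eucl n)) :=
    hball (Metric.mem_ball.2 ((Metric.mem_closedBall.1 hy).trans_lt hr))
  simp only [Set.indicator_of_mem hmem, Set.indicator_of_mem hy']

theorem integral_dilate (η : Eucl n → ℝ) {τ : ℝ} (hτ : 0 < τ) (x : Eucl n) :
    ∫ z, dilate η τ x z = ∫ z, η z := by
  simp only [dilate]
  rw [integral_const_mul, integral_sub_right_eq_self (fun z => η (τ⁻¹ • z)) x,
    Measure.integral_comp_inv_smul_of_nonneg _ _ hτ.le, finrank_euclideanSpace_fin, smul_eq_mul,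
    inv_mul_cancel_left₀ (by positivity)]

/-- The kernel is bounded by `B τ^{-n}` and vanishes off the ball of radius `τ`, so the error is at
most a constant times the mean oscillation of `u` about `u x` there. -/
theorem tendsto_integral_dilate_mul {Ω : Opens (Eucl n)} {u : Eucl n → ℝ}
    (hu : LocallyIntegrableOn u (Ω : Set (Eucl n)) volume) {η : Eucl n → ℝ}
    (hη : ContDiff ℝ ((⊤ : ℕ∞)) η) {s : ℝ} (hs1 : s ≤ 1)
    (hs : tsupport η ⊆ Metric.closedBall 0 s) (hη1 : ∫ z, η z = 1) {x : Eucl n} (hx : x ∈ Ω)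
    (hleb : Filter.Tendsto (fun r => ⨍ y in Metric.closedBall x r, ‖u y - u x‖)
      (nhdsWithin 0 (Set.Ioi 0)) (nhds 0)) :
    Filter.Tendsto (fun τ => ∫ z, dilate η τ x z * u z) (nhdsWithin 0 (Set.Ioi 0))
      (nhds (u x)) := by
  have hcη : HasCompactSupport η :=
    (isCompact_closedBall 0 s).of_isClosed_subset (isClosed_tsupport _) hs
  obtain ⟨B, hB⟩ := hη.continuous.bounded_above_of_compact_support hcη
  have hB0 : 0 ≤ B := (norm_nonneg _).trans (hB 0)
  set w := volume.real (Metric.ball (0 : Eucl n) 1)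
  obtain ⟨R, hR, hRΩ⟩ := Metric.isOpen_iff.1 Ω.isOpen x hx
  rw [tendsto_iff_norm_sub_tendsto_zero]
  have hb := hleb.const_mul (B * w)
  rw [mul_zero] at hb
  refine tendsto_of_tendsto_of_tendsto_of_le_of_le' tendsto_const_nhds hb
    (Filter.Eventually.of_forall fun _ => norm_nonneg _) ?_
  filter_upwards [self_mem_nhdsWithin, nhdsWithin_le_nhds (gt_mem_nhds hR)] with τ hτ hτR
  have hτ : 0 < τ := hτ
  have hsub : Metric.closedBall x τ ⊆ (Ω : Set (Eucl n)) :=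
    (Metric.closedBall_subset_ball hτR).trans hRΩ
  have hts : tsupport (dilate η τ x) ⊆ Metric.closedBall x τ :=
    (tsupport_dilate_subset hs hτ x).trans (Metric.closedBall_subset_closedBall (by nlinarith))
  have hcd := (contDiff_dilate hη τ x).continuous
  have hcc := hasCompactSupport_dilate hs hτ x
  have hint1 := integrable_continuous_mul hu hcd hcc (hts.trans hsub)
  have hint2 : Integrable fun z => dilate η τ x z * u x :=
    (hcd.integrable_of_hasCompactSupport hcc).mul_const _
  have huτ : IntegrableOn (fun z => u z - u x) (Metric.closedBall x τ) volume :=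
    (hu.integrableOn_compact_subset hsub (isCompact_closedBall x τ)).sub
      (integrableOn_const (isCompact_closedBall x τ).measure_lt_top.ne)
  have e1 : (∫ z, dilate η τ x z * u z) - u x = ∫ z, dilate η τ x z * (u z - u x) := by
    simp_rw [mul_sub]
    rw [integral_sub hint1 hint2, integral_mul_const, integral_dilate η hτ x, hη1, one_mul]
  have hvol : volume.real (Metric.closedBall x τ) = τ ^ n * w := by
    rw [Measure.addHaar_real_closedBall _ _ hτ.le, finrank_euclideanSpace_fin]
  have hw : 0 < w := by
    simp only [w, Measure.real]
    exact ENNReal.toReal_pos (volume_ball_ne_zero _ one_pos) (volume_ball_ne_top _ _)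
  rw [e1]
  have hbound : ∀ z, ‖dilate η τ x z * (u z - u x)‖ ≤ (Metric.closedBall x τ).indicator
      (fun z => (τ ^ n)⁻¹ * B * ‖u z - u x‖) z := by
    intro z
    by_cases hz : z ∈ Metric.closedBall x τ
    · rw [Set.indicator_of_mem hz, norm_mul, dilate, norm_mul, Real.norm_of_nonneg (by positivity)]
      gcongr
      exact hB _
    · rw [Set.indicator_of_notMem hz, image_eq_zero_of_notMem_tsupport fun h => hz (hts h)]
      simp
  refine (norm_integral_le_of_norm_le ((integrable_indicator_iff
    Metric.isClosed_closedBall.measurableSet).2 (huτ.norm.const_mul _)) (Filter.Eventually.of_forall hbound)).trans ?_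
  rw [integral_indicator Metric.isClosed_closedBall.measurableSet, integral_const_mul,
    setAverage_eq, hvol, smul_eq_mul]
  refine le_of_eq ?_
  field_simp

/-! ### From Hardy norms to gradients at small scales -/

theorem enorm_le_grandMaximal {Ω : Opens (Eucl n)} {N : ℕ} {R : ℝ≥0∞} (T : 𝓓'(Ω, ℝ))
    {x : Eucl n} {r K : ℝ} (hr : 0 < r) (hrR : ENNReal.ofReal r ≤ R) (hK : 0 < K) (φ : 𝓓(Ω, ℝ))
    (hsupp : tsupport φ ⊆ Metric.ball x r)
    (hφ : ∀ k ≤ N, ∀ y, ‖iteratedFDeriv ℝ k φ y‖ ≤ K * (r ^ (n + k))⁻¹) :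
    ‖T φ‖ₑ ≤ ENNReal.ofReal K * grandMaximal Ω N R T x := by
  have hcoe : ((K⁻¹ • φ : 𝓓(Ω, ℝ)) : Eucl n → ℝ) = K⁻¹ • (φ : Eucl n → ℝ) := rfl
  have hnorm : IsNormalizedTest Ω N x r (K⁻¹ • φ) := by
    constructor
    · rw [hcoe]
      exact (closure_mono (Function.support_const_smul_subset _ _)).trans hsupp
    · intro k hk a y
      have hcd : ContDiffAt ℝ k φ y := (φ.contDiff.of_le (by exact_mod_cast le_top)).contDiffAt
      rw [hcoe, iteratedFDeriv_const_smul_apply hcd, ← Real.norm_eq_abs]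
      refine (ContinuousMultilinearMap.le_opNorm _ _).trans ?_
      simp only [PiLp.norm_single, norm_one, Finset.prod_const_one, mul_one]
      rw [norm_smul, Real.norm_of_nonneg (by positivity), inv_mul_le_iff₀ hK]
      exact hφ k hk y
  have h1 : ‖T (K⁻¹ • φ)‖ₑ ≤ grandMaximal Ω N R T x :=
    le_iSup_of_le r (le_iSup_of_le hr (le_iSup_of_le hrR (le_iSup_of_le _ (le_iSup_of_le hnorm
      le_rfl))))
  have h2 : T φ = K * T (K⁻¹ • φ) := by
    rw [map_smul, smul_eq_mul, mul_inv_cancel_left₀ hK.ne']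
  rw [h2, enorm_mul, Real.enorm_of_nonneg hK.le]
  gcongr

/-- Supplies measurability. The support of an admissible `φ` at `x` lies in a strictly smaller ball,
so for some `r' < r` the same `φ` is admissible at all nearby `y`: the bounds weaken as the scale
shrinks, and the loss in `d(y, ∂Ω)` is absorbed by `r - r'`. -/
theorem lowerSemicontinuous_indicator_grandMaximal (Ω : Opens (Eucl n)) (N : ℕ) (T : 𝓓'(Ω, ℝ)) :
    LowerSemicontinuous ((Ω : Set (Eucl n)).indicator
      fun x => grandMaximal Ω N (bdryDist Ω x / 2) T x) := by
  intro x a ha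
  by_cases hx : x ∈ (Ω : Set (Eucl n))
  swap
  · rw [Set.indicator_of_notMem hx] at ha
    exact absurd ha not_lt_zero
  rw [Set.indicator_of_mem hx] at ha
  simp only [grandMaximal, lt_iSup_iff] at ha
  obtain ⟨r, hr, hrR, φ, hφ, haφ⟩ := ha
  obtain ⟨s, hsr, hs⟩ := exists_lt_subset_ball (isClosed_tsupport φ) hφ.1
  set r' := (max s 0 + r) / 2 with hr'
  have hmr : max s 0 < r := max_lt hsr hr
  have hr'r : r' < r := by linarith
  have hr'0 : 0 < r' := by linarith [le_max_right s 0]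
  have hsr' : s < r' := by linarith [le_max_left s 0]
  have hδ : 0 < min (r' - s) (r - r') := lt_min (by linarith) (by linarith)
  filter_upwards [Metric.ball_mem_nhds x hδ, Ω.isOpen.mem_nhds hx] with y hy hyΩ
  rw [Set.indicator_of_mem hyΩ]
  have hyd := Metric.mem_ball'.1 hy
  have hy1 : dist x y < r' - s := hyd.trans_le (min_le_left _ _)
  have hy2 : dist x y < r - r' := hyd.trans_le (min_le_right _ _)
  have hR : ENNReal.ofReal r' ≤ bdryDist Ω y / 2 := by
    rw [ENNReal.le_div_iff_mul_le (by simp) (by simp)] at hrR ⊢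
    have h1 := hrR.trans (bdryDist_le_edist_add Ω x y)
    have h2 : edist x y + ENNReal.ofReal r' * 2 ≤ ENNReal.ofReal r * 2 := by
      have e : ∀ t : ℝ, ENNReal.ofReal t * 2 = ENNReal.ofReal (t * 2) := fun t => by
        rw [ENNReal.ofReal_mul' two_pos.le, ENNReal.ofReal_ofNat]
      rw [e, e, edist_dist, ← ENNReal.ofReal_add dist_nonneg (by positivity)]
      exact ENNReal.ofReal_le_ofReal (by linarith)
    exact (ENNReal.add_le_add_iff_left (edist_ne_top x y)).1 (h2.trans h1)
  have hnorm : IsNormalizedTest Ω N y r' φ := by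
    refine ⟨hs.trans (Metric.ball_subset_ball' (by linarith)), fun k hk i z => ?_⟩
    exact (hφ.2 k hk i z).trans (by gcongr)
  exact haφ.trans_le (le_iSup_of_le r' (le_iSup_of_le hr'0 (le_iSup_of_le hR
    (le_iSup_of_le φ (le_iSup_of_le hnorm le_rfl)))))

theorem exists_bound_iteratedFDeriv {f : Eucl n → ℝ} (hf : ContDiff ℝ ((⊤ : ℕ∞)) f)
    (hc : HasCompactSupport f) (N : ℕ) :
    ∃ K : ℝ, 0 < K ∧ ∀ k ≤ N, ∀ w, ‖iteratedFDeriv ℝ k f w‖ ≤ K := by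
  have h : ∀ k : ℕ, ∃ B, ∀ w, ‖iteratedFDeriv ℝ k f w‖ ≤ B := fun k =>
    (hf.continuous_iteratedFDeriv (by exact_mod_cast le_top)).bounded_above_of_compact_support
      (hc.iteratedFDeriv k)
  choose B hB using h
  have hB0 : ∀ k, 0 ≤ B k := fun k => (norm_nonneg _).trans (hB k 0)
  refine ⟨∑ k ∈ Finset.range (N + 1), B k + 1,
    by linarith [Finset.sum_nonneg fun k (_ : k ∈ Finset.range (N + 1)) => hB0 k], fun k hk w => ?_⟩
  have := Finset.single_le_sum (fun k _ => hB0 k) (Finset.mem_range.2 (Nat.lt_succ_of_le hk))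
  linarith [hB k w]

/-- The constant must not depend on the direction of translation. It does not, because `w_j η(w -
e)` is the translate by `e` of `w_j η + e_j η`, with `|e_j| ≤ 1`. -/
theorem exists_bound_coordMul_translate {η : Eucl n → ℝ} (hη : ContDiff ℝ ((⊤ : ℕ∞)) η)
    (hc : HasCompactSupport η) (N : ℕ) :
    ∃ K : ℝ, 0 < K ∧ ∀ e : Eucl n, ‖e‖ ≤ 1 → ∀ j, ∀ k ≤ N, ∀ w,
      ‖iteratedFDeriv ℝ k (coordMul (fun w => η (w - e)) j) w‖ ≤ K := by
  obtain ⟨K₀, hK₀, h0⟩ := exists_bound_iteratedFDeriv hη hc N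
  have hj : ∀ j, ∃ K : ℝ, 0 < K ∧ ∀ k ≤ N, ∀ w, ‖iteratedFDeriv ℝ k (coordMul η j) w‖ ≤ K :=
    fun j => exists_bound_iteratedFDeriv (contDiff_coordMul hη j)
      (hc.of_isClosed_subset (isClosed_tsupport _) (tsupport_coordMul_subset η j)) N
  choose K hK h1 using hj
  refine ⟨∑ j, K j + K₀, add_pos_of_nonneg_of_pos (Finset.sum_nonneg fun j _ => (hK j).le) hK₀,
    fun e he j k hk w => ?_⟩
  have hle : ((k : ℕ∞) : WithTop ℕ∞) ≤ ((⊤ : ℕ∞) : WithTop ℕ∞) := by exact_mod_cast le_top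
  have e1 : coordMul (fun w => η (w - e)) j =
      fun w => (coordMul η j + e j • η) (w - e) := by
    funext w
    simp [coordMul]
    ring
  have hcd1 : ContDiffAt ℝ k (coordMul η j) (w - e) :=
    ((contDiff_coordMul hη j).of_le hle).contDiffAt
  have hcd2 : ContDiffAt ℝ k η (w - e) := (hη.of_le hle).contDiffAt
  have hcd3 : ContDiffAt ℝ k (e j • η) (w - e) := hcd2.const_smul (e j)
  rw [e1, iteratedFDeriv_comp_sub (f := coordMul η j + e j • η),
    iteratedFDeriv_add_apply hcd1 hcd3,
    iteratedFDeriv_const_smul_apply hcd2]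
  refine (norm_add_le _ _).trans (add_le_add ?_ ?_)
  · exact (h1 j k hk _).trans (Finset.single_le_sum (fun j _ => (hK j).le) (Finset.mem_univ j))
  · rw [norm_smul]
    have : ‖e j‖ ≤ 1 := (PiLp.norm_apply_le e j).trans he
    nlinarith [h0 k hk (w - e), norm_nonneg (iteratedFDeriv ℝ k η (w - e)), norm_nonneg (e j)]

/-- The mean value inequality for `τ ↦ ∫ η_τ u` on `(0, r]`: the derivative is bounded by `K S`,
because the dilations are test functions at scale `τ`, and the limit at `0` is `u x`. -/
theorem norm_integral_dilate_sub_le {Ω : Opens (Eucl n)} {u : Eucl n → ℝ}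
    (hu : LocallyIntegrableOn u (Ω : Set (Eucl n)) volume) {N : ℕ} {η : Eucl n → ℝ}
    (hη : ContDiff ℝ ((⊤ : ℕ∞)) η) {s : ℝ} (hs1 : s < 1)
    (hs : tsupport η ⊆ Metric.closedBall 0 s) (hη1 : ∫ z, η z = 1) {K : ℝ} (hK : 0 < K)
    (hKη : ∀ j, ∀ k ≤ N, ∀ w, ‖iteratedFDeriv ℝ k (coordMul η j) w‖ ≤ K)
    {x : Eucl n} (hx : x ∈ Ω)
    (hleb : Filter.Tendsto (fun r => ⨍ y in Metric.closedBall x r, ‖u y - u x‖)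
      (nhdsWithin 0 (Set.Ioi 0)) (nhds 0))
    {S : ℝ≥0∞} (hS : S = ∑ j, grandMaximal Ω N (bdryDist Ω x / 2) (partialDeriv Ω j u) x)
    (hSfin : S ≠ ∞) {r : ℝ} (hr : 0 < r) (hrΩ : ENNReal.ofReal (4 * r) ≤ bdryDist Ω x) :
    ‖(∫ z, dilate η r x z * u z) - u x‖ ≤ K * S.toReal * r := by
  set h : ℝ → ℝ := fun τ => ∫ z, dilate η τ x z * u z with hh
  have hR : Metric.closedBall x (2 * r) ⊆ (Ω : Set (Eucl n)) :=
    (Metric.closedBall_subset_ball (by linarith)).trans (ball_subset_of_le_bdryDist hx hrΩ)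
  have hsj : ∀ j, tsupport (coordMul η j) ⊆ Metric.closedBall 0 s := fun j =>
    (tsupport_coordMul_subset η j).trans hs
  have hder : ∀ τ ∈ Set.Ioc 0 r, ∃ d, HasDerivAt h d τ ∧ ‖d‖ ≤ K * S.toReal := by
    intro τ hτ
    have hτΩ : Metric.closedBall x (s * τ) ⊆ (Ω : Set (Eucl n)) :=
      (Metric.closedBall_subset_closedBall (by nlinarith [hτ.1, hτ.2])).trans hR
    set ψ : Fin n → 𝓓(Ω, ℝ) := fun j =>
      testDilate Ω (contDiff_coordMul hη j) (hsj j) hτ.1 x hτΩ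
    refine ⟨_, hasDerivAt_integral_dilate_mul hu hη hs1.le hs hR hτ.1
      (by linarith [hτ.1, hτ.2]) ψ fun j z => rfl, ?_⟩
    have hτR : ENNReal.ofReal τ ≤ bdryDist Ω x / 2 := by
      rw [ENNReal.le_div_iff_mul_le (by simp) (by simp)]
      refine le_trans ?_ hrΩ
      rw [show ENNReal.ofReal τ * 2 = ENNReal.ofReal (τ * 2) by
        rw [ENNReal.ofReal_mul hτ.1.le, ENNReal.ofReal_ofNat]]
      exact ENNReal.ofReal_le_ofReal (by linarith [hτ.2])
    have hj : ∀ j, ‖partialDeriv Ω j u (ψ j)‖ₑ ≤ ENNReal.ofReal K *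
        grandMaximal Ω N (bdryDist Ω x / 2) (partialDeriv Ω j u) x := by
      intro j
      refine enorm_le_grandMaximal _ hτ.1 hτR hK (ψ j) ?_ fun k hk y => ?_
      · exact (tsupport_dilate_subset (hsj j) hτ.1 x).trans
          (Metric.closedBall_subset_ball (by nlinarith [hτ.1]))
      · exact norm_iteratedFDeriv_dilate_le
          ((contDiff_coordMul hη j).of_le (by exact_mod_cast le_top)) (hKη j k hk) hτ.1 x y
    have hsum : ‖∑ j, partialDeriv Ω j u (ψ j)‖ₑ ≤ ENNReal.ofReal K * S := by
      rw [hS, Finset.mul_sum]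
      exact (enorm_sum_le _ _).trans (Finset.sum_le_sum fun j _ => hj j)
    rw [← toReal_enorm]
    refine (ENNReal.toReal_mono (ENNReal.mul_ne_top ENNReal.ofReal_ne_top hSfin) hsum).trans ?_
    rw [ENNReal.toReal_mul, ENNReal.toReal_ofReal hK.le]
  choose! h' hh' hbound using hder
  have hlip : ∀ τ ∈ Set.Ioc 0 r, ‖h r - h τ‖ ≤ K * S.toReal * r := by
    intro τ hτ
    have := (convex_Ioc (0 : ℝ) r).norm_image_sub_le_of_norm_hasDerivWithin_le
      (fun t ht => (hh' t ht).hasDerivWithinAt) hbound hτ (Set.right_mem_Ioc.2 hr)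
    refine this.trans ?_
    rw [Real.norm_of_nonneg (by linarith [hτ.2])]
    have hC : 0 ≤ K * S.toReal := mul_nonneg hK.le ENNReal.toReal_nonneg
    exact mul_le_mul_of_nonneg_left (by linarith [hτ.1]) hC
  have hlim : Filter.Tendsto (fun τ => ‖h r - h τ‖) (nhdsWithin 0 (Set.Ioi 0))
      (nhds ‖h r - u x‖) :=
    (tendsto_const_nhds.sub (tendsto_integral_dilate_mul hu hη hs1.le hs hη1 hx hleb)).norm
  refine le_of_tendsto hlim ?_
  filter_upwards [self_mem_nhdsWithin, nhdsWithin_le_nhds (gt_mem_nhds hr)] with τ hτ hτr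
  exact hlip τ ⟨hτ, hτr.le⟩

/-- At Lebesgue points, the grand maximal functions of the derivatives form a pointwise gradient
at small scales. -/
theorem exists_edist_le_grandMaximal (n N : ℕ) :
    ∃ K : ℝ, 0 < K ∧ ∀ (Ω : Opens (Eucl n)) (u : Eucl n → ℝ),
      LocallyIntegrableOn u (Ω : Set (Eucl n)) volume → ∀ (S : Eucl n → ℝ≥0∞),
      (∀ x ∈ Ω, S x = ∑ j, grandMaximal Ω N (bdryDist Ω x / 2) (partialDeriv Ω j u) x) →
      ∃ F : Set (Eucl n), volume F = 0 ∧ ∀ x ∈ (Ω : Set (Eucl n)) \ F,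
        ∀ y ∈ (Ω : Set (Eucl n)) \ F, S x ≠ ∞ → S y ≠ ∞ →
        edist x y ≤ min (bdryDist Ω x) (bdryDist Ω y) / 4 →
        edist (u x) (u y) ≤ edist x y * (ENNReal.ofReal K * S x + ENNReal.ofReal K * S y) := by
  -- Support radius `1/4` leaves room for a translation by a vector of length `1/2`: the translate
  -- is still supported in the closed ball of radius `3/4`, inside the open unit ball.
  let b : ContDiffBump (0 : Eucl n) := ⟨1 / 8, 1 / 4, by norm_num, by norm_num⟩
  set η : Eucl n → ℝ := b.normed volume with hη
  have hηc : ContDiff ℝ ((⊤ : ℕ∞)) η := b.contDiff_normed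
  have hηs : tsupport η = Metric.closedBall 0 (1 / 4) := b.tsupport_normed_eq
  obtain ⟨K, hK, hKη⟩ := exists_bound_coordMul_translate hηc b.hasCompactSupport_normed N
  refine ⟨K, hK, fun Ω u hu S hS => ?_⟩
  refine ⟨_, ae_iff.1 (ae_tendsto_average_norm_sub hu), ?_⟩
  rintro x ⟨hx, hxF⟩ y ⟨hy, hyF⟩ hSx hSy hxy
  simp only [Set.mem_ofPred_eq, not_not] at hxF hyF
  rcases eq_or_ne x y with rfl | hne
  · simp
  set r := dist x y with hr
  have hr0 : 0 < r := dist_pos.2 hne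
  rw [ENNReal.le_div_iff_mul_le (.inl (by norm_num)) (.inl (by norm_num)), edist_dist,
    show ENNReal.ofReal (dist x y) * 4 = ENNReal.ofReal (4 * r) by
      rw [mul_comm (4 : ℝ), ENNReal.ofReal_mul hr0.le, ENNReal.ofReal_ofNat]] at hxy
  have key : ∀ e : Eucl n, ‖e‖ = 1 / 2 → ∀ a ∈ (Ω : Set (Eucl n)), Filter.Tendsto
      (fun r => ⨍ y in Metric.closedBall a r, ‖u y - u a‖) (nhdsWithin 0 (Set.Ioi 0)) (nhds 0) →
      S a ≠ ∞ → ENNReal.ofReal (4 * r) ≤ bdryDist Ω a →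
      ‖(∫ z, dilate (fun w => η (w - e)) r a z * u z) - u a‖ ≤ K * (S a).toReal * r := by
    intro e he a ha hleb hSa hra
    refine norm_integral_dilate_sub_le hu (hηc.comp (contDiff_id.sub contDiff_const))
      (s := 3 / 4) (by norm_num) ?_ ?_ hK (fun j k hk w => hKη e (by rw [he]; norm_num) j k hk w)
      ha hleb (hS a ha) hSa hr0 hra
    · refine closure_minimal (fun w hw => ?_) Metric.isClosed_closedBall
      have h1 : w - e ∈ tsupport η := subset_tsupport _ hw
      rw [hηs, mem_closedBall_zero_iff] at h1
      rw [mem_closedBall_zero_iff]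
      have := norm_sub_norm_le w e
      linarith
    · change ∫ z, η (z - e) = 1
      rw [integral_sub_right_eq_self η e]
      exact b.integral_normed
  -- With this `e`, the dilation about `x` of `η(· - e)` and the one about `y` of `η(· + e)` are the
  -- same bump about the midpoint. Hence `u x` and `u y` are compared with one number.
  set e : Eucl n := (2 * r)⁻¹ • (y - x) with he
  have hen : ‖e‖ = 1 / 2 := by
    rw [he, norm_smul, Real.norm_of_nonneg (by positivity), ← dist_eq_norm, dist_comm, ← hr]
    field_simp
  have hX := key e hen x hx (hxF hx) hSx (hxy.trans (min_le_left _ _))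
  have hY := key (-e) (by rw [norm_neg, hen]) y hy (hyF hy) hSy (hxy.trans (min_le_right _ _))
  have heq : (∫ z, dilate (fun w => η (w - e)) r x z * u z) =
      ∫ z, dilate (fun w => η (w - -e)) r y z * u z := by
    congr 1
    funext z
    have : r⁻¹ • (z - x) - e = r⁻¹ • (z - y) - -e := by
      have h2 : r⁻¹ • (y - x) = e + e := by
        rw [he, ← add_smul]
        congr 1
        field_simp
        norm_num
      have h3 : r⁻¹ • (z - x) = r⁻¹ • (z - y) + r⁻¹ • (y - x) := by
        rw [← smul_add, sub_add_sub_cancel]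
      rw [h3, h2]
      abel
    simp only [dilate]
    rw [this]
  rw [heq] at hX
  have hreal : dist (u x) (u y) ≤ r * (K * (S x).toReal + K * (S y).toReal) := by
    set I := ∫ z, dilate (fun w => η (w - -e)) r y z * u z
    have h1 : dist I (u x) ≤ K * (S x).toReal * r := by rwa [dist_eq_norm]
    have h2 : dist I (u y) ≤ K * (S y).toReal * r := by rwa [dist_eq_norm]
    have := dist_triangle_left (u x) (u y) I
    linarith
  have hSx0 := mul_nonneg hK.le (ENNReal.toReal_nonneg (a := S x))
  have hSy0 := mul_nonneg hK.le (ENNReal.toReal_nonneg (a := S y))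
  calc edist (u x) (u y) ≤ ENNReal.ofReal (r * (K * (S x).toReal + K * (S y).toReal)) := by
        rw [edist_dist]
        exact ENNReal.ofReal_le_ofReal hreal
    _ = _ := by
        rw [ENNReal.ofReal_mul hr0.le, ENNReal.ofReal_add hSx0 hSy0, ENNReal.ofReal_mul hK.le,
          ENNReal.ofReal_mul hK.le, ENNReal.ofReal_toReal hSx, ENNReal.ofReal_toReal hSy,
          edist_dist]

theorem rpow_sum_le_sum_rpow {ι : Type*} (s : Finset ι) (f : ι → ℝ≥0∞) {p : ℝ} (hp : 0 < p)
    (hp1 : p ≤ 1) : (∑ i ∈ s, f i) ^ p ≤ ∑ i ∈ s, f i ^ p := by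
  classical
  induction s using Finset.induction_on with
  | empty => simp [hp]
  | insert i s hi ih =>
    rw [Finset.sum_insert hi, Finset.sum_insert hi]
    exact (ENNReal.rpow_add_le_add_rpow _ _ hp.le hp1).trans (by gcongr)

/-- The gradient is a multiple of the sum of the grand maximal functions. Subadditivity of `t ↦ t^p`
for `p ≤ 1` bounds its norm, with the factor `n^{1/p}`. -/
theorem exists_isBallGrad_of_hardyNorm {p : ℝ} (hp : 0 < p) (hp1 : p ≤ 1) (n N : ℕ) :
    ∃ C : ℝ≥0∞, C ≠ ∞ ∧ ∀ (Ω : Opens (Eucl n)) (u : Eucl n → ℝ),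
      LocallyIntegrableOn u (Ω : Set (Eucl n)) volume →
      (∀ j, hardyNorm Ω p N (partialDeriv Ω j u) < ∞) →
      ∃ g, MemLpOn Ω p g ∧ IsBallGrad Ω u g ∧
        lpNorm Ω p g ≤ C * ∑ j, hardyNorm Ω p N (partialDeriv Ω j u) := by
  obtain ⟨K, hK, hgrad⟩ := exists_edist_le_grandMaximal n N
  refine ⟨ENNReal.ofReal K * (n : ℝ≥0∞) ^ (1 / p), ENNReal.mul_ne_top ENNReal.ofReal_ne_top
    (ENNReal.rpow_ne_top_of_nonneg (by positivity) (by simp)), fun Ω u hu hfin => ?_⟩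
  set A := ∑ j, hardyNorm Ω p N (partialDeriv Ω j u) with hA
  have hAfin : A ≠ ∞ := (ENNReal.sum_lt_top.2 fun j _ => hfin j).ne
  set M : Fin n → Eucl n → ℝ≥0∞ := fun j => (Ω : Set (Eucl n)).indicator
    fun x => grandMaximal Ω N (bdryDist Ω x / 2) (partialDeriv Ω j u) x with hM
  have hMm : ∀ j, Measurable (M j) := fun j =>
    (lowerSemicontinuous_indicator_grandMaximal Ω N _).measurable
  set S : Eucl n → ℝ≥0∞ := fun x => ∑ j, M j x with hS
  have hSm : Measurable S := Finset.measurable_fun_sum _ fun j _ => hMm j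
  obtain ⟨F, hF, h⟩ := hgrad Ω u hu S fun x hx => by
    simp only [hS, hM, Set.indicator_of_mem (show x ∈ (Ω : Set (Eucl n)) from hx)]
  have hMp : ∀ j, ∫⁻ x in (Ω : Set (Eucl n)), M j x ^ p ≤ A ^ p := by
    intro j
    have h1 : hardyNorm Ω p N (partialDeriv Ω j u) =
        (∫⁻ x in (Ω : Set (Eucl n)), M j x ^ p) ^ (1 / p) := by
      rw [hardyNorm, lpNorm_eq_lintegral Ω hp]
      congr 1
      refine setLIntegral_congr_fun Ω.isOpen.measurableSet fun x hx => ?_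
      simp only [hM, Set.indicator_of_mem hx, enorm_eq_self]
    have h2 : hardyNorm Ω p N (partialDeriv Ω j u) ≤ A :=
      Finset.single_le_sum (f := fun j => hardyNorm Ω p N (partialDeriv Ω j u))
        (fun _ _ => zero_le) (Finset.mem_univ j)
    calc ∫⁻ x in (Ω : Set (Eucl n)), M j x ^ p
        = ((∫⁻ x in (Ω : Set (Eucl n)), M j x ^ p) ^ (1 / p)) ^ p := by
          rw [← ENNReal.rpow_mul, one_div_mul_cancel hp.ne', ENNReal.rpow_one]
      _ ≤ A ^ p := by
          rw [← h1]
          exact ENNReal.rpow_le_rpow h2 hp.le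
  have hGp : ∫⁻ x in (Ω : Set (Eucl n)), (ENNReal.ofReal K * S x) ^ p ≤
      ENNReal.ofReal K ^ p * (n * A ^ p) := by
    calc ∫⁻ x in (Ω : Set (Eucl n)), (ENNReal.ofReal K * S x) ^ p
        = ENNReal.ofReal K ^ p * ∫⁻ x in (Ω : Set (Eucl n)), S x ^ p := by
          simp only [ENNReal.mul_rpow_of_nonneg _ _ hp.le]
          rw [lintegral_const_mul _ (hSm.pow_const p)]
      _ ≤ ENNReal.ofReal K ^ p * ∫⁻ x in (Ω : Set (Eucl n)), ∑ j, M j x ^ p :=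
          mul_le_mul_right (lintegral_mono fun x => rpow_sum_le_sum_rpow _ _ hp hp1) _
      _ = ENNReal.ofReal K ^ p * ∑ j, ∫⁻ x in (Ω : Set (Eucl n)), M j x ^ p := by
          rw [lintegral_finsetSum _ fun j _ => (hMm j).pow_const p]
      _ ≤ ENNReal.ofReal K ^ p * ∑ _j : Fin n, A ^ p := by
          gcongr with j
          exact hMp j
      _ = _ := by simp
  have hfinG : ∫⁻ x in (Ω : Set (Eucl n)), (ENNReal.ofReal K * S x) ^ p ≠ ∞ :=
    ne_top_of_le_ne_top (ENNReal.mul_ne_top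
      (ENNReal.rpow_ne_top_of_nonneg hp.le ENNReal.ofReal_ne_top) (ENNReal.mul_ne_top (by simp)
      (ENNReal.rpow_ne_top_of_nonneg hp.le hAfin))) hGp
  have hSfin : ∀ x, ENNReal.ofReal K * S x ≠ ∞ → S x ≠ ∞ := by
    intro x hx htop
    rw [htop, ENNReal.mul_top (by simpa using hK)] at hx
    exact hx rfl
  obtain ⟨g, F', hg, hF', hnorm, hgg⟩ := exists_real_gradient hp (u := u)
    (P := fun x y => edist x y ≤ min (bdryDist Ω x) (bdryDist Ω y) / 4)
    (hSm.const_mul (ENNReal.ofReal K)).aemeasurable hfinG hF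
    fun x hx y hy hGx hGy hP => h x hx y hy (hSfin x hGx) (hSfin y hGy) hP
  refine ⟨g, hg, ⟨F', hF', hgg⟩, hnorm.trans_le ?_⟩
  refine (ENNReal.rpow_le_rpow hGp (by positivity)).trans (le_of_eq ?_)
  rw [ENNReal.mul_rpow_of_nonneg _ _ (by positivity), ENNReal.mul_rpow_of_nonneg _ _ (by positivity),
    ← ENNReal.rpow_mul, ← ENNReal.rpow_mul, mul_one_div_cancel hp.ne', ENNReal.rpow_one,
    ENNReal.rpow_one, mul_assoc]

/-! ### Equality of the spaces and of the quasi-norms -/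

theorem IsGrad.isBallGrad {Ω : Opens (Eucl n)} {u g : Eucl n → ℝ} (h : IsGrad Ω u g) :
    IsBallGrad Ω u g := by
  obtain ⟨F, hF, h⟩ := h
  exact ⟨F, hF, fun x hx y hy _ => h x hx y hy⟩

theorem iInf_le_of_mem {ι : Type*} {P Q : ι → Prop} {f : ι → ℝ≥0∞} {i : ι} (hP : P i)
    (hQ : Q i) : ⨅ (i) (_ : P i) (_ : Q i), f i ≤ f i :=
  iInf_le_of_le i (iInf_le_of_le hP (iInf_le_of_le hQ le_rfl))

theorem le_mul_iInf_of_forall_le {ι : Type*} {P Q : ι → Prop} {f : ι → ℝ≥0∞} {a C : ℝ≥0∞}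
    (hC0 : C ≠ 0) (hC : C ≠ ∞) (h : ∀ i, P i → Q i → a ≤ C * f i) :
    a ≤ C * ⨅ (i) (_ : P i) (_ : Q i), f i := by
  rw [← ENNReal.div_le_iff' hC0 hC]
  exact le_iInf fun i => le_iInf fun hP => le_iInf fun hQ =>
    (ENNReal.div_le_iff' hC0 hC).2 (h i hP hQ)

end HardySobolev

open HardySobolev in
theorem mainTheorem5 (n : ℕ) (hn : 1 ≤ n) (p : ℝ) (hp : (n : ℝ) / (n + 1) < p) (hp1 : p ≤ 1)
    (N : ℕ) (hN : max 0 ((n : ℝ) * (1 / p - 1)) < N)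
    (Ω : Opens (EuclideanSpace ℝ (Fin n))) (hΩ : HardySobolev.IsUniformDomain Ω) :
    (HardySobolev.spaceMBall Ω p = HardySobolev.spaceM Ω p ∧
      ∃ C : ℝ≥0, 0 < C ∧ ∀ u ∈ HardySobolev.spaceM Ω p,
        HardySobolev.normMBall Ω p u ≤ C * HardySobolev.normM Ω p u ∧
        HardySobolev.normM Ω p u ≤ C * HardySobolev.normMBall Ω p u) ∧
    (HardySobolev.spaceH Ω p N = HardySobolev.spaceM Ω p ∧
      ∃ C : ℝ≥0, 0 < C ∧ ∀ u ∈ HardySobolev.spaceM Ω p,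
        HardySobolev.normH Ω p N u ≤ C * HardySobolev.normM Ω p u ∧
        HardySobolev.normM Ω p u ≤ C * HardySobolev.normH Ω p N u) := by
  have hp0 : 0 < p := lt_of_le_of_lt (by positivity) hp
  have hN1 : 1 ≤ N := by
    have : (0 : ℝ) < N := (le_max_left _ _).trans_lt hN
    exact_mod_cast this
  obtain ⟨C₁, hC₁, hball⟩ := exists_isGrad_of_isBallGrad hn hp hΩ
  obtain ⟨C₂, hC₂, hhardy⟩ := exists_hardyNorm_partialDeriv_le hn hp hp1
  obtain ⟨C₃, hC₃, hback⟩ := exists_isBallGrad_of_hardyNorm hp0 hp1 n N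
  have hMB : spaceMBall Ω p = spaceM Ω p := by
    refine Set.Subset.antisymm ?_ ?_
    · rintro u ⟨hu, g, hg, hug⟩
      obtain ⟨g', hg', hug', -⟩ := hball u g hg hug
      exact ⟨hu, g', hg', hug'⟩
    · rintro u ⟨hu, g, hg, hug⟩
      exact ⟨hu, g, hg, hug.isBallGrad⟩
  have hHM : spaceH Ω p N = spaceM Ω p := by
    refine Set.Subset.antisymm ?_ ?_
    · rintro u ⟨hloc, hu, hder⟩
      obtain ⟨g, hg, hug, -⟩ := hback Ω u hloc hder
      obtain ⟨g', hg', hug', -⟩ := hball u g hg hug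
      exact ⟨hu, g', hg', hug'⟩
    · rintro u ⟨hu, g, hg, hug⟩
      exact ⟨locallyIntegrableOn_of_isGrad hp hp1 hu hg hug, hu, fun j =>
        (hhardy Ω u g hu hg hug N hN1 j).trans_lt (ENNReal.mul_lt_top hC₂.lt_top hg.2)⟩
  -- The added `1` makes the constants positive and takes care of the common term `‖u‖_p`; in the
  -- second constant one summand serves each direction.
  refine ⟨⟨hMB, C₁.toNNReal + 1, by positivity, fun u _ => ⟨?_, ?_⟩⟩,
    ⟨hHM, (n * C₂ + C₁ * C₃).toNNReal + 1, by positivity, fun u huM => ⟨?_, ?_⟩⟩⟩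
  · calc normMBall Ω p u ≤ 1 * normM Ω p u := by
          rw [one_mul]
          refine add_le_add_left (le_iInf fun g => le_iInf fun hg => le_iInf fun hug => ?_) _
          exact iInf_le_of_mem hg hug.isBallGrad
      _ ≤ _ := by
          gcongr
          exact_mod_cast le_add_self
  · have hC : ((C₁.toNNReal + 1 : ℝ≥0) : ℝ≥0∞) = C₁ + 1 := by
      rw [ENNReal.coe_add, ENNReal.coe_toNNReal hC₁, ENNReal.coe_one]
    rw [hC, normM, normMBall, mul_add]
    refine add_le_add ?_ (le_mul_of_one_le_left zero_le le_add_self)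
    refine le_mul_iInf_of_forall_le (by positivity) (by finiteness) fun g hg hug => ?_
    obtain ⟨g', hg', hug', hle⟩ := hball u g hg hug
    exact (iInf_le_of_mem hg' hug').trans (hle.trans (by gcongr; exact le_self_add))
  · have hC : (((n * C₂ + C₁ * C₃).toNNReal + 1 : ℝ≥0) : ℝ≥0∞) = n * C₂ + C₁ * C₃ + 1 := by
      rw [ENNReal.coe_add, ENNReal.coe_toNNReal (by finiteness), ENNReal.coe_one]
    rw [hC, normH, normM, mul_add]
    refine add_le_add ?_ (le_mul_of_one_le_left zero_le le_add_self)
    refine le_mul_iInf_of_forall_le (by positivity) (by finiteness) fun g hg hug => ?_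
    calc ∑ j, hardyNorm Ω p N (partialDeriv Ω j u) ≤ ∑ _j : Fin n, C₂ * lpNorm Ω p g :=
          Finset.sum_le_sum fun j _ => hhardy Ω u g huM.1 hg hug N hN1 j
      _ = n * C₂ * lpNorm Ω p g := by simp [mul_assoc]
      _ ≤ _ := by
          gcongr
          rw [add_assoc]
          exact le_self_add
  · have hC : (((n * C₂ + C₁ * C₃).toNNReal + 1 : ℝ≥0) : ℝ≥0∞) = n * C₂ + C₁ * C₃ + 1 := by
      rw [ENNReal.coe_add, ENNReal.coe_toNNReal (by finiteness), ENNReal.coe_one]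
    rw [hC, normH, normM, mul_add]
    refine add_le_add ?_ (le_mul_of_one_le_left zero_le le_add_self)
    have huH : u ∈ spaceH Ω p N := hHM ▸ huM
    obtain ⟨g, hg, hug, hle⟩ := hback Ω u huH.1 huH.2.2
    obtain ⟨g', hg', hug', hle'⟩ := hball u g hg hug
    refine (iInf_le_of_mem hg' hug').trans ?_
    calc lpNorm Ω p g' ≤ C₁ * (C₃ * ∑ j, hardyNorm Ω p N (partialDeriv Ω j u)) := hle'.trans (by gcongr)
      _ = C₁ * C₃ * ∑ j, hardyNorm Ω p N (partialDeriv Ω j u) := by rw [mul_assoc]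
      _ ≤ _ := by
          gcongr
          exact le_add_self.trans le_self_add
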